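/- Let $n\ge 1$ and let $\Sigma$ be a closed, connected smooth manifold of dimension $2n-1$. A Hamiltonian structure on $\Sigma$ is a smooth closed two-form $\omega$ whose kernel $\ker\omega=\{v:\iota_v\omega=0\}$ is a one-dimensional distribution. A contact form for $(\Sigma,\omega)$ is a smooth one-form $\lambda$ with $d\lambda=\omega$ such that $\lambda\wedge\omega^{n-1}$ vanishes nowhere. Suppose $(\Sigma,\omega,\rho)$ is a real Hamiltonian manifold: $\omega$ is a Hamiltonian structure on $\Sigma$, the line bundle $\ker\omega$ is orientable (equivalently, $\Sigma$ is orientable), and $\rho\colon\Sigma\to\Sigma$ is a smooth involution with $\rho^*\omega=-\omega$ which reverses the orientation of $\ker\omega$. Let $\lambda$ be a contact form for $(\Sigma,\omega)$, and put $$\lambda^\rho=\tfrac12(\lambda-\rho^*\lambda),\qquad \lambda_t=(1-t)\lambda-t\,\rho^*\lambda\quad(t\in[0,1]),$$ so that $\lambda_0=\lambda$ and $\lambda_{1/2}=\lambda^\rho$. Then: 1. $\rho^*\lambda^\rho=-\lambda^\rho$, and $\lambda^\rho$ is a contact form for $(\Sigma,\omega)$. 2. The contact structures $\ker\lambda$ and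 $\ker\lambda^\rho$ are isotopic: there is a smooth isotopy $(\psi_t)_{t\in[0,1]}$ of diffeomorphisms of $\Sigma$ with $\psi_0=\mathrm{id}$ and $(\psi_1)_*\ker\lambda=\ker\lambda^\rho$. 3. More precisely, every $\lambda_t$, $t\in[0,1]$, is a contact form for $(\Sigma,\omega)$, and there is a smooth isotopy $(\varphi_t)_{t\in[0,1]}$ of diffeomorphisms of $\Sigma$ with $\varphi_0=\mathrm{id}$ and $(\varphi_t)_*\ker\lambda=\ker\lambda_t$ for all $t\in[0,1]$. -/

import Mathlib

open Set Topology
open scoped Manifold ContDiff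

noncomputable section

/-! ### Wedge products of alternating forms on a real vector space -/

/-- The wedge product of two alternating forms: the sum over `(p, q)`-shuffles of the signed
products, so that for instance `(a ∧ b) (v, w) = a v * b w - a w * b v` for covectors `a`, `b`. -/
def wedge {V : Type*} [AddCommGroup V] [Module ℝ V] {p q : ℕ}
    (a : V [⋀^Fin p]→ₗ[ℝ] ℝ) (b : V [⋀^Fin q]→ₗ[ℝ] ℝ) : V [⋀^Fin (p + q)]→ₗ[ℝ] ℝ :=
  ((LinearMap.mul' ℝ ℝ).compAlternatingMap (a.domCoprod b)).domDomCongr finSumFinEquiv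

/-- The exterior power `b ∧ ⋯ ∧ b` (`k` factors) of an alternating two-form `b`. -/
def wedgePow {V : Type*} [AddCommGroup V] [Module ℝ V] (b : V [⋀^Fin 2]→ₗ[ℝ] ℝ) :
    (k : ℕ) → V [⋀^Fin (2 * k)]→ₗ[ℝ] ℝ
  | 0 => (AlternatingMap.constOfIsEmpty ℝ V (Fin 0) (1 : ℝ) : V [⋀^Fin 0]→ₗ[ℝ] ℝ)
  | k + 1 => wedge (wedgePow b k) b

section Manifold

variable {d : ℕ} {M : Type*} [TopologicalSpace M] [ChartedSpace (EuclideanSpace ℝ (Fin d)) M]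

/-! ### Differential forms on a manifold without boundary of dimension `d` -/

/-- A (not necessarily smooth) differential form of degree `k` on the `d`-dimensional manifold
`M`: an alternating `k`-form on each tangent space. -/
abbrev DForm (d : ℕ) (M : Type*) [TopologicalSpace M]
    [ChartedSpace (EuclideanSpace ℝ (Fin d)) M] (k : ℕ) : Type _ :=
  (x : M) → (TangentSpace (𝓡 d) x) [⋀^Fin k]→L[ℝ] ℝ

namespace DForm

/-- The pullback `f^* α` of a form by a map `f : M → M`. -/
def pullback {k : ℕ} (f : M → M) (α : DForm d M k) : DForm d M k :=
  fun x ↦ (α (f x)).compContinuousLinearMap (mfderiv (𝓡 d) (𝓡 d) f x)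

/-- The expression of `α` in the preferred chart at `x₀`: the pullback of `α` by the inverse of
that chart, a form on (an open subset of) the model space. -/
def inChart {k : ℕ} (α : DForm d M k) (x₀ : M) :
    EuclideanSpace ℝ (Fin d) → (EuclideanSpace ℝ (Fin d)) [⋀^Fin k]→L[ℝ] ℝ :=
  fun y ↦ (α ((extChartAt (𝓡 d) x₀).symm y)).compContinuousLinearMap
    (mfderiv 𝓘(ℝ, EuclideanSpace ℝ (Fin d)) (𝓡 d) (extChartAt (𝓡 d) x₀).symm y)

/-- A form is smooth if it is smooth in charts (the preferred charts cover `M`). -/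
def IsSmooth {k : ℕ} (α : DForm d M k) : Prop :=
  ∀ x₀ : M, ContDiffOn ℝ ∞ (α.inChart x₀) (extChartAt (𝓡 d) x₀).target

/-- The exterior derivative: at `x`, express the form in the preferred chart at `x`, take the
exterior derivative on the model space, and pull back by the chart. -/
def extd {k : ℕ} (α : DForm d M k) : DForm d M (k + 1) :=
  fun x ↦ (extDeriv (α.inChart x) (extChartAt (𝓡 d) x x)).compContinuousLinearMap
    (mfderiv (𝓡 d) 𝓘(ℝ, EuclideanSpace ℝ (Fin d)) (extChartAt (𝓡 d) x) x)

/-- The kernel of a form of positive degree at `x`: the vectors `v ∈ T_x M` with `ι_v α_x = 0`. -/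
def ker {k : ℕ} (α : DForm d M (k + 1)) (x : M) : Submodule ℝ (TangentSpace (𝓡 d) x) :=
  LinearMap.ker (α x).toAlternatingMap.curryLeft

end DForm

/-! ### Hamiltonian structures, contact forms, real structures -/

/-- A Hamiltonian structure: a smooth closed two-form whose kernel is one-dimensional. -/
structure IsHamiltonianStructure (Ω : DForm d M 2) : Prop where
  smooth : Ω.IsSmooth
  closed : Ω.extd = 0
  finrank_ker : ∀ x, Module.finrank ℝ (Ω.ker x) = 1

/-- A contact form on the Hamiltonian manifold `(M, Ω)`, `dim M = 2 n - 1`: a smooth one-form `l`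
with `dl = Ω` such that `l ∧ Ω ^ (n - 1)` vanishes nowhere. -/
structure IsContactForm (n : ℕ) (Ω : DForm d M 2) (l : DForm d M 1) : Prop where
  smooth : l.IsSmooth
  extd_eq : l.extd = Ω
  wedge_ne_zero : ∀ x,
    wedge (l x).toAlternatingMap (wedgePow (Ω x).toAlternatingMap (n - 1)) ≠ 0

/-- An orientation of the line bundle `ker Ω`: a choice of a half-line in each fibre which is
locally spanned by a continuous vector field. -/
structure KerOrientation [IsManifold (𝓡 d) ∞ M] (Ω : DForm d M 2) where
  ray : ∀ x, Module.Ray ℝ (Ω.ker x)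
  locally_spanned : ∀ x₀ : M, ∃ U ∈ 𝓝 x₀, ∃ X : (x : M) → TangentSpace (𝓡 d) x,
    ContinuousOn (fun x ↦ (⟨x, X x⟩ : TangentBundle (𝓡 d) M)) U ∧
    ∀ x ∈ U, ∃ (hX : X x ∈ Ω.ker x) (h0 : (⟨X x, hX⟩ : Ω.ker x) ≠ 0),
      ray x = rayOfNeZero ℝ (⟨X x, hX⟩ : Ω.ker x) h0

/-- The differential of `ρ` sends positive vectors of `ker Ω` to negative vectors of `ker Ω`. -/
def KerOrientation.IsReversedBy [IsManifold (𝓡 d) ∞ M] {Ω : DForm d M 2}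
    (o : KerOrientation Ω) (ρ : M → M) : Prop :=
  ∀ (x : M) (v : Ω.ker x) (hv : v ≠ 0), rayOfNeZero ℝ v hv = o.ray x →
    ∃ (hw : mfderiv (𝓡 d) (𝓡 d) ρ x v ∈ Ω.ker (ρ x))
      (h0 : (⟨mfderiv (𝓡 d) (𝓡 d) ρ x v, hw⟩ : Ω.ker (ρ x)) ≠ 0),
      rayOfNeZero ℝ (⟨mfderiv (𝓡 d) (𝓡 d) ρ x v, hw⟩ : Ω.ker (ρ x)) h0 = -o.ray (ρ x)

/-- `ρ` is a real structure on the Hamiltonian manifold `(M, Ω)`: a smooth anti-symplectic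
involution which reverses the orientation of the line bundle `ker Ω`. (On a connected `M` the two
orientations of `ker Ω` are opposite to each other, so it does not matter which one is used.) -/
structure IsRealStructure [IsManifold (𝓡 d) ∞ M] (Ω : DForm d M 2) (ρ : M → M) : Prop where
  smooth : ContMDiff (𝓡 d) (𝓡 d) ∞ ρ
  involutive : Function.Involutive ρ
  pullback_eq : DForm.pullback ρ Ω = -Ω
  reverses : ∃ o : KerOrientation Ω, o.IsReversedBy ρ

/-- The antisymmetrization `(l - ρ^* l) / 2` of a one-form. -/
def antisymmetrization (ρ : M → M) (l : DForm d M 1) : DForm d M 1 :=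
  (1 / 2 : ℝ) • (l - DForm.pullback ρ l)

/-- The linear path `l_t = (1 - t) l - t ρ^* l` of one-forms. -/
def linearPath (ρ : M → M) (l : DForm d M 1) (t : ℝ) : DForm d M 1 :=
  (1 - t) • l - t • DForm.pullback ρ l

/-- `φ_t`, `0 ≤ t ≤ 1`, is a smooth isotopy of `M` starting at the identity.
(The values at other times are irrelevant.) -/
structure IsSmoothIsotopy (φ : ℝ → (M ≃ₘ⟮𝓡 d, 𝓡 d⟯ M)) : Prop where
  map_zero : ∀ x, φ 0 x = x
  smooth : ContMDiffOn (𝓘(ℝ, ℝ).prod (𝓡 d)) (𝓡 d) ∞ (fun p : ℝ × M ↦ φ p.1 p.2)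
    (Icc (0 : ℝ) 1 ×ˢ univ)

/-- The differential of `f` maps the distribution `ξ` onto the distribution `η`. -/
def MapsDistribution (f : M → M) (ξ η : (x : M) → Submodule ℝ (TangentSpace (𝓡 d) x)) : Prop :=
  ∀ x, (ξ x).map (mfderiv (𝓡 d) (𝓡 d) f x).toLinearMap = η (f x)

/-- Two distributions are isotopic if the time-one map of a smooth isotopy of `M` carries the
first to the second. -/
def AreIsotopic (ξ η : (x : M) → Submodule ℝ (TangentSpace (𝓡 d) x)) : Prop :=
  ∃ φ : ℝ → (M ≃ₘ⟮𝓡 d, 𝓡 d⟯ M), IsSmoothIsotopy φ ∧ MapsDistribution (φ 1) ξ η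

end Manifold

end

/-! Since `ker Ω` is a line, a primitive of `Ω` is a contact form exactly when it does not vanish on
nonzero kernel vectors: a top-degree form with a nonzero vector in its kernel is zero, and two
one-forms nonzero on the kernel give proportional products with `Ω ^ (n - 1)`
(`wedge_wedgePow_eq_zero`, `wedge_wedgePow_ne_zero`). As `M` is connected, a contact form `l` has
constant sign on positive kernel vectors (`KerOrientation.constant_sign`). The involution reverses
the orientation, so `ρ^* l` has the opposite sign (`mul_pullback_neg`), and `(1 - t) l - t ρ^* l`
never vanishes on the kernel. Its differential is `(1 - t) Ω + t Ω = Ω`. Hence the whole path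
consists of contact forms; antisymmetry at `t = 1/2` is formal.

The isotopy is Gray stability by Moser's method. Write `l_t = l - t β` with `β = l + ρ^* l`, and let
`R_t` be the Reeb field. Let `X_t` be the field in `ker l_t` with `ι_{X_t} Ω = β - β(R_t) l_t`. If
`Φ_t` is its flow, Cartan's formula gives `d/dt Φ_t^* l_t = Φ_t^* (ι_{X_t} Ω - β) = -(β(R_t) ∘ Φ_t)
Φ_t^* l_t`. For a fixed tangent vector this is a scalar linear equation, so `Φ_t^* l_t` vanishes on
it if and only if `l` does (`hasDerivAt_affinePath_flow`, `eq_zero_iff_of_hasDerivAt_mul`).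

The smooth flow is built from scratch. Local flows are `C^n` by the implicit function theorem
applied to the integral equation in a Banach space of curves (`exists_contDiffAt_flow_of_contDiff`).
They are glued to a global flow for compactly supported fields (`exists_global_flow`), and time
dependence is handled by a cut-off suspension on `ℝ × M` (`exists_isotopy_of_timeDependent`). -/

noncomputable section

/-! ### Differentiability of post-composition on spaces of continuous maps -/

section Nemytskii

/-- Pointwise application of a continuous family of continuous linear maps to a continuous
family of vectors, as a continuous bilinear map. -/
def pointwiseApply (K : Type*) [TopologicalSpace K] [CompactSpace K] (E F : Type*) [NormedAddCommGroup E] [NormedSpace ℝ E] [NormedAddCommGroup F] [NormedSpace ℝ F] :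
    C(K, E →L[ℝ] F) →L[ℝ] C(K, E) →L[ℝ] C(K, F) :=
  LinearMap.mkContinuous₂
    (LinearMap.mk₂ ℝ (fun (A : C(K, E →L[ℝ] F)) (g : C(K, E)) ↦ (⟨fun s ↦ A s (g s), by fun_prop⟩ : C(K, F)))
      (fun _ _ _ ↦ by ext; simp) (fun _ _ _ ↦ by ext; simp)
      (fun _ _ _ ↦ by ext; simp) (fun _ _ _ ↦ by ext; simp)) 1
    (fun A g ↦ by
      rw [one_mul, ContinuousMap.norm_le _ (by positivity)]
      exact fun s ↦ (A s).le_of_opNorm_le_of_le (A.norm_coe_le_norm s) (g.norm_coe_le_norm s))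

variable {K : Type*} [TopologicalSpace K] [CompactSpace K]

@[simp] lemma pointwiseApply_apply {E F : Type*}
    [NormedAddCommGroup E] [NormedSpace ℝ E] [NormedAddCommGroup F] [NormedSpace ℝ F]
    (A : C(K, E →L[ℝ] F)) (g : C(K, E)) (s : K) : pointwiseApply K E F A g s = A s (g s) := rfl

universe u

lemma exists_dist_comp_lt {E G : Type*} [PseudoMetricSpace E] [PseudoMetricSpace G]
    (f : C(E, G)) (g : C(K, E)) {c : ℝ} (hc : 0 < c) :
    ∃ δ > 0, ∀ k : C(K, E), dist k g < δ → dist (f.comp k) (f.comp g) < c :=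
  Metric.continuous_iff.1 (ContinuousMap.continuous_postcomp f) g c hc

/-- The mean value inequality bounds the remainder at each `s`. The radius is uniform in `s` because
post-composition with `f'` is continuous for the sup norm. -/
lemma hasFDerivAt_continuousMap_comp {E F : Type*}
    [NormedAddCommGroup E] [NormedSpace ℝ E] [NormedAddCommGroup F] [NormedSpace ℝ F]
    (f : C(E, F)) (f' : C(E, E →L[ℝ] F)) (h : ∀ x, HasFDerivAt f (f' x) x) (g : C(K, E)) :
    HasFDerivAt (fun g : C(K, E) ↦ f.comp g) (pointwiseApply K E F (f'.comp g)) g := by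
  rw [hasFDerivAt_iff_isLittleO_nhds_zero, Asymptotics.isLittleO_iff]
  intro c hc
  obtain ⟨δ, hδ, hb⟩ := exists_dist_comp_lt f' g hc
  filter_upwards [Metric.ball_mem_nhds (0 : C(K, E)) hδ] with k hk
  rw [mem_ball_zero_iff] at hk
  rw [ContinuousMap.norm_le _ (by positivity)]
  intro s
  have key : ‖f (g s + k s) - f (g s) - f' (g s) (g s + k s - g s)‖ ≤ c * ‖g s + k s - g s‖ := by
    refine (convex_ball (g s) δ).norm_image_sub_le_of_norm_hasFDerivWithin_le'
      (fun x _ ↦ (h x).hasFDerivWithinAt) (fun x hx ↦ ?_) (Metric.mem_ball_self hδ) ?_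
    -- The translate of `g` by the constant `x - g s` takes the value `x` at `s` and stays within
    -- `δ` of `g`, so the sup-norm bound applies to `f' x - f' (g s)`.
    · have h1 : dist (g + ContinuousMap.const K (x - g s)) g < δ := by
        rw [dist_eq_norm, add_sub_cancel_left]
        refine lt_of_le_of_lt ((ContinuousMap.norm_le _ (norm_nonneg (x - g s))).2 fun _ ↦ le_rfl) ?_
        rwa [← dist_eq_norm]
      have h2 := (ContinuousMap.dist_lt_iff hc).1 (hb _ h1) s
      simp only [ContinuousMap.comp_apply, ContinuousMap.add_apply, ContinuousMap.const_apply,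
        add_sub_cancel, dist_eq_norm] at h2
      exact h2.le
    · rw [Metric.mem_ball, dist_eq_norm, add_sub_cancel_left]
      exact (k.norm_coe_le_norm s).trans_lt hk
  rw [add_sub_cancel_left] at key
  refine le_trans key ?_
  gcongr
  exact k.norm_coe_le_norm s

/-- Induction on `n`: the derivative is a continuous linear operator applied to post-composition
with `fderiv ℝ f`. The target becomes `E →L[ℝ] F`, hence the quantification over `F` and the common
universe. -/
lemma contDiff_nat_continuousMap_comp {E : Type u} [NormedAddCommGroup E] [NormedSpace ℝ E] (n : ℕ) :
    ∀ {F : Type u} [NormedAddCommGroup F] [NormedSpace ℝ F] (f : C(E, F)), ContDiff ℝ n f →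
      ContDiff ℝ n (fun g : C(K, E) ↦ f.comp g) := by
  induction n with
  | zero => exact fun f _ ↦ contDiff_zero.2 (ContinuousMap.continuous_postcomp f)
  | succ n ih =>
    intro F _ _ f hf
    have hf' : ContDiff ℝ n (fderiv ℝ f) := hf.fderiv_right (by norm_cast)
    have hd : Differentiable ℝ f := hf.differentiable (by norm_cast)
    push_cast
    rw [contDiff_succ_iff_hasFDerivAt]
    refine ⟨fun g ↦ pointwiseApply K E F
      ((⟨fderiv ℝ f, hf'.continuous⟩ : C(E, E →L[ℝ] F)).comp g), ?_, ?_⟩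
    · exact (pointwiseApply K E F).contDiff.comp (ih ⟨fderiv ℝ f, hf'.continuous⟩ hf')
    · exact fun g ↦ hasFDerivAt_continuousMap_comp f _ (fun x ↦ (hd x).hasFDerivAt) g

end Nemytskii

/-! ### Local flows in a Banach space by the implicit function theorem -/

section LocalFlow

variable {E : Type*} [NormedAddCommGroup E] [NormedSpace ℝ E]

/-- The primitive `s ↦ ∫ r in 0..s, g r` of a continuous curve on the unit interval. -/
def primitiveCLM (E : Type*) [NormedAddCommGroup E] [NormedSpace ℝ E] :
    C(Icc (0 : ℝ) 1, E) →L[ℝ] C(Icc (0 : ℝ) 1, E) :=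
  LinearMap.mkContinuous
    { toFun := fun g ↦ ⟨fun s ↦ ∫ r in (0 : ℝ)..s, g.IccExtend zero_le_one r,
        (intervalIntegral.continuous_primitive
          (fun a b ↦ (g.IccExtend zero_le_one).continuous.intervalIntegrable a b) 0).comp
          continuous_subtype_val⟩
      map_add' := fun g h ↦ by
        ext s
        exact intervalIntegral.integral_add
          ((g.IccExtend zero_le_one).continuous.intervalIntegrable _ _)
          ((h.IccExtend zero_le_one).continuous.intervalIntegrable _ _)
      map_smul' := fun c g ↦ by
        ext s
        exact intervalIntegral.integral_smul c _ } 1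
    (fun g ↦ by
      rw [one_mul, ContinuousMap.norm_le _ (by positivity)]
      intro s
      refine (intervalIntegral.norm_integral_le_of_norm_le_const (C := ‖g‖)
        fun r _ ↦ g.norm_coe_le_norm _).trans ?_
      rw [sub_zero, abs_of_nonneg s.2.1]
      exact mul_le_of_le_one_right (norm_nonneg _) s.2.2)

lemma primitiveCLM_apply (g : C(Icc (0 : ℝ) 1, E)) (s : Icc (0 : ℝ) 1) :
    primitiveCLM E g s = ∫ r in (0 : ℝ)..s, g.IccExtend zero_le_one r := rfl

/-- The integral equation for curves on the unit interval satisfying `g' = τ f(g)`, `g 0 = x`. -/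
def integralEquation (f : C(E, E)) (p : (E × ℝ) × C(Icc (0 : ℝ) 1, E)) : C(Icc (0 : ℝ) 1, E) :=
  p.2 - ContinuousMap.const _ p.1.1 - p.1.2 • primitiveCLM E (f.comp p.2)

lemma contDiff_const_continuousMap {n : WithTop ℕ∞} :
    ContDiff ℝ n (fun x : E ↦ (ContinuousMap.const (Icc (0 : ℝ) 1) x)) := by
  let c : E →ₗ[ℝ] C(Icc (0 : ℝ) 1, E) :=
    { toFun := fun x ↦ ContinuousMap.const _ x
      map_add' := fun _ _ ↦ rfl
      map_smul' := fun _ _ ↦ rfl }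
  exact (c.mkContinuous 1 fun x ↦ by
    rw [one_mul, ContinuousMap.norm_le _ (by positivity)]
    exact fun _ ↦ le_rfl).contDiff

lemma contDiff_continuousMap_eval {n : WithTop ℕ∞} (s : Icc (0 : ℝ) 1) :
    ContDiff ℝ n (fun g : C(Icc (0 : ℝ) 1, E) ↦ g s) := by
  let c : C(Icc (0 : ℝ) 1, E) →ₗ[ℝ] E :=
    { toFun := fun g ↦ g s
      map_add' := fun _ _ ↦ rfl
      map_smul' := fun _ _ ↦ rfl }
  exact (c.mkContinuous 1 fun g ↦ by
    rw [one_mul]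
    exact g.norm_coe_le_norm s).contDiff

lemma contDiff_integralEquation {n : ℕ} (f : C(E, E)) (hf : ContDiff ℝ n f) :
    ContDiff ℝ n (integralEquation f) := by
  unfold integralEquation
  refine (contDiff_snd.sub (contDiff_const_continuousMap.comp (contDiff_fst.comp contDiff_fst))).sub
    ((contDiff_snd.comp contDiff_fst).smul ?_)
  exact (primitiveCLM E).contDiff.comp ((contDiff_nat_continuousMap_comp n f hf).comp contDiff_snd)

/-- At `τ = 0` the equation reads `g - x₀`, so its partial derivative in the curve is the identity
and the implicit function theorem applies. Rescaling time to the unit interval is what turns time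
into the parameter `τ`. -/
lemma fderiv_integralEquation_inr {n : ℕ} (hn : n ≠ 0) (f : C(E, E)) (hf : ContDiff ℝ n f) (x₀ : E) 
    (g : C(Icc (0 : ℝ) 1, E)) :
    fderiv ℝ (integralEquation f) ((x₀, 0), g) ∘L
      ContinuousLinearMap.inr ℝ (E × ℝ) C(Icc (0 : ℝ) 1, E) = ContinuousLinearMap.id ℝ _ := by
  have h1 : HasFDerivAt (integralEquation f) (fderiv ℝ (integralEquation f) ((x₀, 0), g))
      ((x₀, 0), g) :=
    (((contDiff_integralEquation f hf).differentiable (by exact_mod_cast hn)) _).hasFDerivAt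
  have h2 := HasFDerivAt.comp g h1 (hasFDerivAt_prodMk_right (𝕜 := ℝ) ((x₀, 0) : E × ℝ) g)
  refine h2.unique ?_
  have : integralEquation f ∘ (fun g' ↦ ((x₀, (0 : ℝ)), g')) =
      fun g' ↦ g' - ContinuousMap.const _ x₀ := by
    ext g' : 1
    simp [integralEquation]
  rw [this]
  exact (hasFDerivAt_id g).sub_const _

variable [CompleteSpace E]

/-- Picard–Lindelöf supplies a continuous flow `a`. The rescaled curve `s ↦ a (x, τ * s)` solves the
integral equation and is close to the constant `x₀`, so it equals the `C^n` implicit function;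
evaluation at `s = 1` gives `a (x, τ)`. -/
lemma exists_contDiffAt_flow_of_contDiff {n : ℕ} (hn : n ≠ 0) (f : C(E, E)) (hf : ContDiff ℝ n f)
    (x₀ : E) :
    ∃ ε > 0, ∃ a : E × ℝ → E, ContDiffAt ℝ n a (x₀, 0) ∧ ∀ x ∈ Metric.ball x₀ ε,
      a (x, 0) = x ∧ ∀ t ∈ Ioo (-ε) ε, HasDerivAt (fun s ↦ a (x, s)) (f (a (x, t))) t := by
  obtain ⟨ε, hε, b, r, L, K, hr, hpl⟩ := IsPicardLindelof.of_contDiffAt_one (x₀ := x₀)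
    (hf.contDiffAt.of_le (by exact_mod_cast Nat.one_le_iff_ne_zero.2 hn))
  obtain ⟨a, ha, hac⟩ := (hpl 0).exists_forall_mem_closedBall_eq_hasDerivWithinAt_continuousOn
  simp only [zero_sub, zero_add] at ha hac
  have hda : ∀ x ∈ Metric.closedBall x₀ r, ∀ t ∈ Ioo (-ε) ε,
      HasDerivAt (fun s ↦ a (x, s)) (f (a (x, t))) t := fun x hx t ht ↦
    ((ha x hx).2 t (Ioo_subset_Icc_self ht)).hasDerivAt (Icc_mem_nhds ht.1 ht.2)
  have hr' : (0 : ℝ) < r := hr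
  refine ⟨min ε r, lt_min hε hr', a, ?_, fun x hx ↦ ?_⟩
  swap
  · have hx' : x ∈ Metric.closedBall x₀ r :=
      Metric.ball_subset_closedBall (Metric.ball_subset_ball (min_le_right _ _) hx)
    refine ⟨(ha x hx').1, fun t ht ↦ hda x hx' t ?_⟩
    exact ⟨(neg_le_neg (min_le_left _ _)).trans_lt ht.1, ht.2.trans_le (min_le_left _ _)⟩
  set g₀ : C(Icc (0 : ℝ) 1, E) := ContinuousMap.const _ x₀ with hg₀
  have hG : ContDiffAt ℝ n (integralEquation f) ((x₀, 0), g₀) :=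
    (contDiff_integralEquation f hf).contDiffAt
  have hn' : (n : WithTop ℕ∞) ≠ 0 := by exact_mod_cast hn
  have hinv : (fderiv ℝ (integralEquation f) ((x₀, 0), g₀) ∘L
      ContinuousLinearMap.inr ℝ (E × ℝ) C(Icc (0 : ℝ) 1, E)).IsInvertible := by
    rw [fderiv_integralEquation_inr hn f hf]
    exact ⟨ContinuousLinearEquiv.refl ℝ _, rfl⟩
  have hG0 : integralEquation f ((x₀, 0), g₀) = 0 := by simp [integralEquation, hg₀]
  have hev := hG.eventually_apply_eq_iff_implicitFunction hn' hinv
  have hsm := hG.contDiffAt_implicitFunction hn' hinv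
  rw [hG0] at hev
  set g := hG.implicitFunction hn' hinv
  have hsm1 : ContDiffAt ℝ n (fun p ↦ g p ⟨1, by simp⟩) (x₀, (0 : ℝ)) :=
    (contDiff_continuousMap_eval ⟨1, by simp⟩).contDiffAt.comp _ hsm
  refine hsm1.congr_of_eventuallyEq ?_
  obtain ⟨η, hη, hball⟩ := Metric.eventually_nhds_iff.1 hev
  have hcont : ContinuousAt a (x₀, 0) := hac.continuousAt
    (prod_mem_nhds (Metric.closedBall_mem_nhds _ hr') (Icc_mem_nhds (by linarith) hε))
  obtain ⟨δ, hδ, hδb⟩ := Metric.continuousAt_iff.1 hcont (η / 2) (by positivity)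
  rw [(ha x₀ (Metric.mem_closedBall_self hr'.le)).1] at hδb
  have hmin : 0 < min (min δ (η / 2)) (min ε r) := by positivity
  filter_upwards [Metric.ball_mem_nhds (x₀, (0 : ℝ)) hmin]
  rintro ⟨x, τ⟩ hp
  simp only [Metric.mem_ball, Prod.dist_eq, max_lt_iff, lt_min_iff, Real.dist_eq, sub_zero] at hp
  obtain ⟨⟨⟨hx1, hτ1⟩, hx2, hτ2⟩, ⟨-, hτ3⟩, hx4, -⟩ := hp
  have hxr : x ∈ Metric.closedBall x₀ r := hx4.le
  have habs : ∀ s ∈ Icc (0 : ℝ) 1, |τ * s| ≤ |τ| := fun s hs ↦ by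
    rw [abs_mul, abs_of_nonneg hs.1]
    exact mul_le_of_le_one_right (abs_nonneg _) hs.2
  have hmem : ∀ s ∈ Icc (0 : ℝ) 1, τ * s ∈ Ioo (-ε) ε := fun s hs ↦
    abs_lt.1 ((habs s hs).trans_lt hτ3)
  have hder : ∀ s ∈ Icc (0 : ℝ) 1,
      HasDerivAt (fun s ↦ a (x, τ * s)) (τ • f (a (x, τ * s))) s := fun s hs ↦ by
    have := HasDerivAt.scomp s (hda x hxr _ (hmem s hs)) ((hasDerivAt_id s).const_mul τ)
    simpa [Function.comp_def] using this
  have hcs : ContinuousOn (fun s ↦ a (x, τ * s)) (Icc (0 : ℝ) 1) := fun s hs ↦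
    (hder s hs).continuousAt.continuousWithinAt
  let c : C(Icc (0 : ℝ) 1, E) := ⟨fun s ↦ a (x, τ * s), hcs.domRestrict⟩
  have hc : integralEquation f ((x, τ), c) = 0 := by
    ext s
    have hs : Icc (0 : ℝ) s ⊆ Icc 0 1 := Icc_subset_Icc_right s.2.2
    have hI : ∫ r in (0 : ℝ)..s, τ • f (a (x, τ * r)) = a (x, τ * s) - a (x, τ * 0) := by
      refine intervalIntegral.integral_eq_sub_of_hasDerivAt (f := fun s ↦ a (x, τ * s)) ?_ ?_
      · rw [uIcc_of_le s.2.1]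
        exact fun r hr ↦ hder r (hs hr)
      · refine ContinuousOn.intervalIntegrable ?_
        rw [uIcc_of_le s.2.1]
        exact continuousOn_const.smul (f.continuous.comp_continuousOn (hcs.mono hs))
    have hI2 : ∫ r in (0 : ℝ)..s, ((f.comp c).IccExtend zero_le_one) r =
        ∫ r in (0 : ℝ)..s, f (a (x, τ * r)) := by
      refine intervalIntegral.integral_congr fun r hr ↦ ?_
      rw [uIcc_of_le s.2.1] at hr
      simp only [ContinuousMap.coe_IccExtend]
      rw [IccExtend_of_mem _ _ (hs hr)]
      rfl
    rw [intervalIntegral.integral_smul, mul_zero, (ha x hxr).1] at hI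
    simp only [integralEquation, ContinuousMap.sub_apply, ContinuousMap.smul_apply,
      primitiveCLM_apply, hI2, hI, ContinuousMap.const_apply, ContinuousMap.zero_apply]
    exact sub_self _
  -- Local uniqueness in the implicit function theorem needs the curve itself to be near `g₀` in the
  -- sup norm; continuity of `a` at `(x₀, 0)` gives this.
  have hdist : dist ((x, τ), c) ((x₀, 0), g₀) < η := by
    rw [Prod.dist_eq, Prod.dist_eq, max_lt_iff, max_lt_iff, Real.dist_eq, sub_zero]
    refine ⟨⟨by dsimp only; linarith, by dsimp only; linarith⟩, ?_⟩
    refine lt_of_le_of_lt ((ContinuousMap.dist_le (C := η / 2) (by positivity)).2 fun s ↦ ?_)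
      (by linarith)
    refine (hδb ?_).le
    rw [Prod.dist_eq, max_lt_iff, Real.dist_eq, sub_zero]
    exact ⟨hx1, (habs s s.2).trans_lt hτ1⟩
  have := (hball hdist).1 hc
  dsimp only at this
  rw [this]
  change a (x, τ) = a (x, τ * 1)
  rw [mul_one]

/-- The local flow of a vector field which is `C^n` at a point is `C^n` at that point. -/
theorem exists_contDiffAt_flow [FiniteDimensional ℝ E] {n : ℕ} (hn : n ≠ 0) {f : E → E} {x₀ : E}
    (hf : ContDiffAt ℝ n f x₀) :
    ∃ ε > 0, ∃ a : E × ℝ → E, ContDiffAt ℝ n a (x₀, 0) ∧ ∀ x ∈ Metric.ball x₀ ε,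
      a (x, 0) = x ∧ ∀ t ∈ Ioo (-ε) ε, HasDerivAt (fun s ↦ a (x, s)) (f (a (x, t))) t := by
  obtain ⟨u, hu, hfu⟩ := hf.contDiffOn le_rfl (by simp)
  obtain ⟨w, hwu, hwo, hxw⟩ := mem_nhds_iff.1 hu
  obtain ⟨r, hr, hrw⟩ := Metric.nhds_basis_closedBall.mem_iff.1 (hwo.mem_nhds hxw)
  -- Cutting `f` off makes it globally `C^n`; for small times the flow stays in the inner ball,
  -- where `χ = 1`, so it is also a flow of `f`.
  let χ : ContDiffBump x₀ := ⟨r / 2, r, by positivity, by linarith⟩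
  have hF : ContDiff ℝ n (fun x ↦ χ x • f x) := by
    refine contDiff_iff_contDiffAt.2 fun x ↦ ?_
    by_cases hx : x ∈ w
    · exact χ.contDiff.contDiffAt.smul ((hfu.mono hwu).contDiffAt (hwo.mem_nhds hx))
    · have hx' : x ∉ tsupport χ := fun h ↦ hx (hrw (by rwa [χ.tsupport_eq] at h))
      refine (contDiffAt_const (c := (0 : E))).congr_of_eventuallyEq ?_
      filter_upwards [(isClosed_tsupport χ).isOpen_compl.mem_nhds hx'] with y hy
      rw [image_eq_zero_of_notMem_tsupport hy, zero_smul]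
  obtain ⟨ε, hε, a, hac, ha⟩ := exists_contDiffAt_flow_of_contDiff hn ⟨_, hF.continuous⟩ hF x₀
  have hcont : ContinuousAt a (x₀, 0) := hac.continuousAt
  obtain ⟨δ, hδ, hδb⟩ := Metric.continuousAt_iff.1 hcont (r / 2) (by positivity)
  rw [(ha x₀ (Metric.mem_ball_self hε)).1] at hδb
  refine ⟨min ε δ, lt_min hε hδ, a, hac, fun x hx ↦ ?_⟩
  rw [Metric.mem_ball, lt_min_iff] at hx
  refine ⟨(ha x hx.1).1, fun t ht ↦ ?_⟩
  replace ht := abs_lt.2 ht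
  have hd := (ha x hx.1).2 t (abs_lt.1 (ht.trans_le (min_le_left _ _)))
  have hb : a (x, t) ∈ Metric.closedBall x₀ χ.rIn := by
    refine (hδb ?_).le
    rw [Prod.dist_eq, max_lt_iff, Real.dist_eq, sub_zero]
    exact ⟨hx.2, ht.trans_le (min_le_right _ _)⟩
  simpa [χ.one_of_mem_closedBall hb] using hd

end LocalFlow

/-! ### Local and global flows on a manifold -/

section ManifoldFlow

variable {E : Type*} [NormedAddCommGroup E] [NormedSpace ℝ E] [FiniteDimensional ℝ E]
  {H : Type*} [TopologicalSpace H] {I : ModelWithCorners ℝ E H}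
  {N : Type*} [TopologicalSpace N] [ChartedSpace H N] [IsManifold I ∞ N]
  [I.Boundaryless]

omit [FiniteDimensional ℝ E] in
/-- If `f` solves, in the chart at `x₀`, the differential equation given by the vector field `v`,
then it comes from an integral curve of `v`. -/
lemma hasMFDerivAt_extChartAt_symm_comp {v : (x : N) → TangentSpace I x} {x₀ : N} {f : ℝ → E}
    {t : ℝ} (hf3 : f t ∈ (extChartAt I x₀).target)
    (h : HasDerivAt f (tangentCoordChange I ((extChartAt I x₀).symm (f t)) x₀
      ((extChartAt I x₀).symm (f t)) (v ((extChartAt I x₀).symm (f t)))) t) :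
    HasMFDerivAt 𝓘(ℝ, ℝ) I ((extChartAt I x₀).symm ∘ f) t
      ((1 : ℝ →L[ℝ] ℝ).smulRight (v ((extChartAt I x₀).symm (f t)))) := by
  let xₜ : N := (extChartAt I x₀).symm (f t)
  have hft1 : xₜ ∈ (extChartAt I x₀).source := (extChartAt I x₀).map_target hf3
  have hft2 := mem_extChartAt_source (I := I) xₜ
  let w : E := v xₜ
  have hw : tangentCoordChange I x₀ xₜ xₜ (tangentCoordChange I xₜ x₀ xₜ w) = w := by
    rw [tangentCoordChange_comp ⟨⟨hft2, hft1⟩, hft2⟩, tangentCoordChange_self hft2]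
  have h2 : HasDerivAt f (tangentCoordChange I xₜ x₀ xₜ w) t := h
  have hc := hasFDerivWithinAt_tangentCoordChange (I := I) (x := x₀) (y := xₜ) ⟨hft1, hft2⟩
  rw [(extChartAt I x₀).right_inv hf3, I.range_eq_univ, hasFDerivWithinAt_univ] at hc
  have key := hc.comp_hasDerivAt t h2
  rw [hw] at key
  exact ⟨(continuousAt_extChartAt_symm'' hf3).comp h.continuousAt,
    key.hasFDerivAt.hasFDerivWithinAt (s := range 𝓘(ℝ, ℝ))⟩

/-- A vector field of class `C^n` on a manifold without boundary has local flows of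
class `C^n`. -/
theorem exists_local_flow {n : ℕ} (hn : n ≠ 0) {v : (x : N) → TangentSpace I x} {x₀ : N}
    (hv : ContMDiffAt I I.tangent n (fun x ↦ (⟨x, v x⟩ : TangentBundle I N)) x₀) :
    ∃ ε > 0, ∃ u ∈ 𝓝 x₀, ∃ F : ℝ × N → N,
      ContMDiffOn (𝓘(ℝ, ℝ).prod I) I n F (Ioo (-ε) ε ×ˢ u) ∧
      ∀ x ∈ u, F (0, x) = x ∧ IsMIntegralCurveOn (fun t ↦ F (t, x)) v (Ioo (-ε) ε) := by
  have : IsManifold I n N := .of_le (n := ∞) (by exact_mod_cast le_top)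
  rw [contMDiffAt_iff] at hv
  obtain ⟨_, hv⟩ := hv
  obtain ⟨ε, hε, a, hac, ha⟩ := exists_contDiffAt_flow hn (hv.contDiffAt
    (range_mem_nhds_isInteriorPoint BoundarylessManifold.isInteriorPoint)).snd
  have hcont : ContinuousAt a (extChartAt I x₀ x₀, 0) := hac.continuousAt
  obtain ⟨w, hw, haw⟩ := hac.contDiffOn le_rfl (by simp)
  have hε' : (0 : ℝ) < ε := hε
  have ha0 : a (extChartAt I x₀ x₀, 0) = extChartAt I x₀ x₀ := (ha _ (Metric.mem_ball_self hε')).1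
  have htar : a ⁻¹' (extChartAt I x₀).target ∈ 𝓝 (extChartAt I x₀ x₀, (0 : ℝ)) :=
    hcont (by rw [ha0]; exact extChartAt_target_mem_nhds x₀)
  obtain ⟨u₁, hu₁, u₂, hu₂, hu⟩ := mem_nhds_prod_iff.1 (Filter.inter_mem hw htar)
  obtain ⟨δ, hδ, hδu⟩ := Metric.mem_nhds_iff.1 hu₂
  rw [Real.ball_eq_Ioo, zero_sub, zero_add] at hδu
  have hIoo : Ioo (-min ε δ) (min ε δ) ⊆ Ioo (-ε) ε ∩ Ioo (-δ) δ := fun t ht ↦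
    ⟨⟨(neg_le_neg (min_le_left _ _)).trans_lt ht.1, ht.2.trans_le (min_le_left _ _)⟩,
      ⟨(neg_le_neg (min_le_right _ _)).trans_lt ht.1, ht.2.trans_le (min_le_right _ _)⟩⟩
  refine ⟨min ε δ, lt_min hε hδ, (extChartAt I x₀).source ∩ extChartAt I x₀ ⁻¹'
    (Metric.ball (extChartAt I x₀ x₀) ε ∩ u₁), ?_,
    fun p ↦ (extChartAt I x₀).symm (a (extChartAt I x₀ p.2, p.1)), ?_, ?_⟩
  · exact Filter.inter_mem (extChartAt_source_mem_nhds x₀)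
      ((continuousAt_extChartAt x₀) (Filter.inter_mem (Metric.ball_mem_nhds _ hε) hu₁))
  · refine (contMDiffOn_extChartAt_symm (n := n) x₀).comp
      (t := (extChartAt I x₀).target) ?_ fun p hp ↦ ?_
    · refine (haw.contMDiffOn).comp (t := w) ?_ fun p hp ↦ ?_
      · refine ContMDiffOn.prodMk_space ?_ contMDiffOn_fst
        refine (contMDiffOn_extChartAt (n := n) (x := x₀)).comp contMDiffOn_snd fun p hp ↦ ?_
        have := hp.2.1
        rwa [extChartAt_source] at this
      · exact (hu ⟨hp.2.2.2, hδu (hIoo hp.1).2⟩).1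
    · exact (hu ⟨hp.2.2.2, hδu (hIoo hp.1).2⟩).2
  · rintro x ⟨hx1, hx2, hx3⟩
    refine ⟨?_, fun t ht ↦ ?_⟩
    · dsimp only
      rw [(ha _ hx2).1, (extChartAt I x₀).left_inv hx1]
    · refine HasMFDerivAt.hasMFDerivWithinAt ?_
      exact hasMFDerivAt_extChartAt_symm_comp (f := fun t ↦ a (extChartAt I x₀ x, t))
        (hu ⟨hx3, hδu (hIoo ht).2⟩).2 ((ha _ hx2).2 t (hIoo ht).1)

/-- The statement that `v` has a `C^n` local flow near `x` which is defined for times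
in `(-ε, ε)`. -/
def HasLocalFlowAt (v : (x : N) → TangentSpace I x) (n : ℕ) (ε : ℝ) (x : N) : Prop :=
  ∃ u ∈ 𝓝 x, ∃ F : ℝ × N → N, ContMDiffOn (𝓘(ℝ, ℝ).prod I) I n F (Ioo (-ε) ε ×ˢ u) ∧
    ∀ x ∈ u, F (0, x) = x ∧ IsMIntegralCurveOn (fun t ↦ F (t, x)) v (Ioo (-ε) ε)

omit [FiniteDimensional ℝ E] [IsManifold I ∞ N] [I.Boundaryless] in
lemma HasLocalFlowAt.mono {v : (x : N) → TangentSpace I x} {n : ℕ} {ε δ : ℝ} {x : N}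
    (h : HasLocalFlowAt v n ε x) (hδ : δ ≤ ε) : HasLocalFlowAt v n δ x := by
  obtain ⟨u, hu, F, hF, h⟩ := h
  have hI : Ioo (-δ) δ ⊆ Ioo (-ε) ε := Ioo_subset_Ioo (neg_le_neg hδ) hδ
  exact ⟨u, hu, F, hF.mono (prod_mono hI subset_rfl), fun x hx ↦ ⟨(h x hx).1, (h x hx).2.mono hI⟩⟩

/-- A common existence time on `K` comes from induction on compact sets: it exists near each point,
and a minimum serves for a union. -/
lemma exists_hasLocalFlowAt_of_isCompact {n : ℕ} (hn : n ≠ 0) {v : (x : N) → TangentSpace I x}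
    (hv : ContMDiff I I.tangent n (fun x ↦ (⟨x, v x⟩ : TangentBundle I N)))
    {K : Set N} (hK : IsCompact K) : ∃ ε > 0, ∀ x ∈ K, HasLocalFlowAt v n ε x := by
  refine hK.induction_on (p := fun s ↦ ∃ ε > 0, ∀ x ∈ s, HasLocalFlowAt v n ε x)
    ⟨1, one_pos, by simp⟩ (fun s t hst ⟨ε, hε, h⟩ ↦ ⟨ε, hε, fun x hx ↦ h x (hst hx)⟩) ?_ ?_
  · rintro s t ⟨ε, hε, hs⟩ ⟨δ, hδ, ht⟩
    refine ⟨min ε δ, lt_min hε hδ, fun x hx ↦ ?_⟩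
    rcases hx with hx | hx
    · exact (hs x hx).mono (min_le_left _ _)
    · exact (ht x hx).mono (min_le_right _ _)
  · intro x _
    obtain ⟨ε, hε, u, hu, F, hF, h⟩ := exists_local_flow hn (hv x)
    obtain ⟨w, hwu, hwo, hxw⟩ := mem_nhds_iff.1 hu
    exact ⟨w, mem_nhdsWithin_of_mem_nhds (hwo.mem_nhds hxw), ε, hε,
      fun y hy ↦ ⟨u, Filter.mem_of_superset (hwo.mem_nhds hy) hwu, F, hF, h⟩⟩

omit [FiniteDimensional ℝ E] [IsManifold I ∞ N] [I.Boundaryless] in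
/-- A global flow which is locally of class `C^n` for small times is of class `C^n`. -/
lemma contMDiff_flow_of_small_times {F : ℝ × N → N} {n : WithTop ℕ∞}
    (hadd : ∀ s t x, F (s + t, x) = F (s, F (t, x))) (h0 : ∀ x, F (0, x) = x) {ε : ℝ} (hε : 0 < ε)
    (hF : ∀ t x, |t| < ε → ContMDiffAt (𝓘(ℝ, ℝ).prod I) I n F (t, x)) :
    ContMDiff (𝓘(ℝ, ℝ).prod I) I n F := by
  -- `F (k t, ·)` is the `k`-fold iterate of `F (t, ·)`, so regularity for small `t` propagates to
  -- `k t`.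
  have key (k : ℕ) (t : ℝ) (x : N) (ht : |t| < ε) :
      ContMDiffAt (𝓘(ℝ, ℝ).prod I) I n (fun p : ℝ × N ↦ F (k * p.1, p.2)) (t, x) := by
    induction k with
    | zero => simpa [h0] using contMDiffAt_snd
    | succ k ih =>
      have h1 : (fun p : ℝ × N ↦ F ((k + 1 : ℕ) * p.1, p.2)) =
          F ∘ fun p : ℝ × N ↦ (p.1, F (k * p.1, p.2)) := by
        ext p
        rw [Function.comp_apply, ← hadd]
        push_cast
        ring_nf
      rw [h1]
      exact ContMDiffAt.comp _ (hF _ _ ht) (contMDiffAt_fst.prodMk ih)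
  rintro ⟨t, x⟩
  -- With this `m` the time `t / m` is shorter than `ε`, and `F (t, x) = F (m * (t / m), x)`.
  obtain ⟨m, hm⟩ := exists_nat_gt (|t| / ε)
  have hm0 : (0 : ℝ) < m := lt_of_le_of_lt (by positivity) hm
  have h1 : F = (fun p : ℝ × N ↦ F (m * p.1, p.2)) ∘ fun p : ℝ × N ↦ ((m : ℝ)⁻¹ * p.1, p.2) := by
    ext p
    simp [mul_inv_cancel_left₀ hm0.ne']
  rw [h1]
  refine ContMDiffAt.comp _ (key m _ _ ?_) ?_
  · rw [abs_mul, abs_inv, Nat.abs_cast, inv_mul_lt_iff₀ hm0]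
    rwa [div_lt_iff₀ hε] at hm
  · have hmul : ContDiff ℝ n (fun s : ℝ ↦ (m : ℝ)⁻¹ * s) := contDiff_const.mul contDiff_id
    exact (hmul.contMDiff.contMDiffAt.comp (t, x) contMDiffAt_fst).prodMk contMDiffAt_snd

/-- A compactly supported smooth vector field on a manifold without boundary has a smooth
global flow. -/
theorem exists_global_flow [T2Space N] {v : (x : N) → TangentSpace I x}
    (hv : ContMDiff I I.tangent ∞ (fun x ↦ (⟨x, v x⟩ : TangentBundle I N)))
    {K : Set N} (hK : IsCompact K) (hvK : ∀ x ∉ K, v x = 0) :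
    ∃ F : ℝ × N → N, ContMDiff (𝓘(ℝ, ℝ).prod I) I ∞ F ∧ (∀ x, F (0, x) = x) ∧
      (∀ x, IsMIntegralCurve (fun t ↦ F (t, x)) v) ∧
      ∀ s t x, F (s + t, x) = F (s, F (t, x)) := by
  have hvn (n : ℕ) : ContMDiff I I.tangent n (fun x ↦ (⟨x, v x⟩ : TangentBundle I N)) :=
    hv.of_le (by exact_mod_cast le_top)
  have hv1 : ContMDiff I I.tangent 1 (fun x ↦ (⟨x, v x⟩ : TangentBundle I N)) := hvn 1
  have hex : ∀ x, ∃ γ : ℝ → N, γ 0 = x ∧ IsMIntegralCurve γ v := by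
    obtain ⟨ε, hε, h⟩ := exists_hasLocalFlowAt_of_isCompact one_ne_zero (hvn 1) hK
    refine exists_isMIntegralCurve_of_isMIntegralCurveOn hv1 hε fun x ↦ ?_
    by_cases hx : x ∈ K
    · obtain ⟨u, hu, F, -, hF⟩ := h x hx
      exact ⟨fun t ↦ F (t, x), hF x (mem_of_mem_nhds hu)⟩
    -- The field vanishes outside `K`, so constant curves are integral curves there and one `ε`
    -- serves all of `N`.
    · exact ⟨fun _ ↦ x, rfl, (isMIntegralCurve_const (hvK x hx)).isMIntegralCurveOn _⟩
  choose γ hγ0 hγ using hex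
  have hadd : ∀ s t x, γ x (s + t) = γ (γ x t) s := fun s t x ↦ by
    refine congrFun (isMIntegralCurve_Ioo_eq_of_contMDiff_boundaryless (t₀ := 0) hv1
      ((hγ x).comp_add t) (hγ (γ x t)) ?_) s
    simp [hγ0]
  refine ⟨fun p ↦ γ p.2 p.1, ?_, hγ0, hγ, hadd⟩
  refine contMDiff_infty.2 fun n ↦ ?_
  -- The local theory needs at least one derivative; order `n`, including `0`, is recovered from
  -- order `n + 1`.
  suffices h : ∀ n : ℕ, n ≠ 0 → ContMDiff (𝓘(ℝ, ℝ).prod I) I n (fun p : ℝ × N ↦ γ p.2 p.1) from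
    (h (n + 1) n.succ_ne_zero).of_le (by exact_mod_cast n.le_succ)
  intro n hn
  obtain ⟨ε, hε, h⟩ := exists_hasLocalFlowAt_of_isCompact hn (hvn n) hK
  refine contMDiff_flow_of_small_times hadd hγ0 hε fun t x ht ↦ ?_
  by_cases hx : x ∈ K
  · obtain ⟨u, hu, F, hF, h⟩ := h x hx
    have hn : Ioo (-ε) ε ×ˢ u ∈ 𝓝 (t, x) :=
      prod_mem_nhds (isOpen_Ioo.mem_nhds (abs_lt.1 ht)) hu
    refine (hF.contMDiffAt hn).congr_of_eventuallyEq (Filter.mem_of_superset hn ?_)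
    rintro ⟨s, y⟩ ⟨hs, hy⟩
    refine isMIntegralCurveOn_Ioo_eqOn_of_contMDiff_boundaryless (t₀ := 0) ⟨by linarith, hε⟩ hv1
      ((hγ y).isMIntegralCurveOn _) (h y hy).2 ?_ hs
    rw [hγ0, (h y hy).1]
  · refine contMDiffAt_snd.congr_of_eventuallyEq ?_
    filter_upwards [(continuousAt_snd (p := (t, x))).preimage_mem_nhds (hK.isClosed.isOpen_compl.mem_nhds hx)]
    rintro ⟨s, y⟩ (hy : y ∉ K)
    refine congrFun (isMIntegralCurve_Ioo_eq_of_contMDiff_boundaryless (t₀ := 0) hv1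
      (hγ y) (isMIntegralCurve_const (hvK y hy)) ?_) s
    exact hγ0 y

end ManifoldFlow

/-! ### Time-dependent vector fields and isotopies -/

section TimeDependent

variable {E : Type*} [NormedAddCommGroup E] [NormedSpace ℝ E]
  {H : Type*} [TopologicalSpace H] {I : ModelWithCorners ℝ E H}
  {M : Type*} [TopologicalSpace M] [ChartedSpace H M] [IsManifold I ∞ M]
  {E' : Type*} [NormedAddCommGroup E'] [NormedSpace ℝ E']
  {H' : Type*} [TopologicalSpace H'] {J : ModelWithCorners ℝ E' H'}
  {P : Type*} [TopologicalSpace P] [ChartedSpace H' P]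

lemma trivializationAt_tangent_snd_eq_mfderiv {x₀ x : M} (hx : x ∈ (chartAt H x₀).source)
    (v : TangentSpace I x) :
    (trivializationAt E (TangentSpace I) x₀ (⟨x, v⟩ : TangentBundle I M)).2 =
      mfderiv I 𝓘(ℝ, E) (extChartAt I x₀) x v := by
  refine Eq.trans ?_ (congrArg (fun L : TangentSpace I x →L[ℝ] E ↦ L v)
    (TangentBundle.continuousLinearMapAt_trivializationAt hx))
  rw [Bundle.Trivialization.continuousLinearMapAt_apply,
    Bundle.Trivialization.coe_linearMapAt_of_mem]
  rwa [TangentBundle.trivializationAt_baseSet]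

/-- A vector field along a map is smooth if and only if the map and the coordinate expression of
the vector field are smooth. -/
lemma contMDiffAt_tangentBundle_iff {n : WithTop ℕ∞} {g : P → M}
    {X : (p : P) → TangentSpace I (g p)} {p₀ : P} :
    ContMDiffAt J I.tangent n (fun p ↦ (⟨g p, X p⟩ : TangentBundle I M)) p₀ ↔
      ContMDiffAt J I n g p₀ ∧ ContMDiffAt J 𝓘(ℝ, E) n
        (fun p ↦ (mfderiv I 𝓘(ℝ, E) (extChartAt I (g p₀)) (g p) (X p) : E)) p₀ := by
  rw [Bundle.contMDiffAt_totalSpace]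
  refine and_congr_right fun hg ↦ Filter.EventuallyEq.contMDiffAt_iff ?_
  filter_upwards [hg.continuousAt ((chartAt H (g p₀)).open_source.mem_nhds
    (mem_chart_source H (g p₀)))] with p hp
  exact trivializationAt_tangent_snd_eq_mfderiv hp _

lemma ContMDiffAt.smul_tangent {n : WithTop ℕ∞} {g : P → M}
    {X : (p : P) → TangentSpace I (g p)} {p₀ : P} {c : P → ℝ}
    (hX : ContMDiffAt J I.tangent n (fun p ↦ (⟨g p, X p⟩ : TangentBundle I M)) p₀)
    (hc : ContMDiffAt J 𝓘(ℝ, ℝ) n c p₀) :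
    ContMDiffAt J I.tangent n (fun p ↦ (⟨g p, c p • X p⟩ : TangentBundle I M)) p₀ := by
  rw [contMDiffAt_tangentBundle_iff] at hX ⊢
  refine ⟨hX.1, ?_⟩
  simp only [map_smul]
  exact hc.smul hX.2

/-- The vector field `θ ∂_t + θ V_t` on `ℝ × M`. -/
def suspension (θ : ℝ → ℝ) (V : ℝ → (x : M) → TangentSpace I x) (p : ℝ × M) :
    TangentSpace (𝓘(ℝ, ℝ).prod I) p :=
  ((θ p.1, θ p.1 • V p.1 p.2) : TangentSpace 𝓘(ℝ, ℝ) p.1 × TangentSpace I p.2)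

/-- No regularity of `V` is needed outside `T`: the support of `θ` is closed and contained in `T`,
so near a time outside `T` the second component is the zero section. -/
lemma contMDiff_suspension {θ : ℝ → ℝ} (hθ : ContDiff ℝ ∞ θ)
    {V : ℝ → (x : M) → TangentSpace I x} {T : Set ℝ} (hT : IsOpen T) (hθT : tsupport θ ⊆ T)
    (hV : ContMDiffOn (𝓘(ℝ, ℝ).prod I) I.tangent ∞
      (fun p : ℝ × M ↦ (⟨p.2, V p.1 p.2⟩ : TangentBundle I M)) (T ×ˢ univ)) :
    ContMDiff (𝓘(ℝ, ℝ).prod I) (𝓘(ℝ, ℝ).prod I).tangent ∞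
      (fun p ↦ (⟨p, suspension θ V p⟩ : TangentBundle (𝓘(ℝ, ℝ).prod I) (ℝ × M))) := by
  have h1 : ContMDiff (𝓘(ℝ, ℝ).prod I) 𝓘(ℝ, ℝ).tangent ∞
      (fun p : ℝ × M ↦ (⟨p.1, θ p.1⟩ : TangentBundle 𝓘(ℝ, ℝ) ℝ)) :=
    (contMDiff_vectorSpace_iff_contDiff.2 hθ).comp contMDiff_fst
  have h2 : ContMDiff (𝓘(ℝ, ℝ).prod I) I.tangent ∞
      (fun p : ℝ × M ↦ (⟨p.2, θ p.1 • V p.1 p.2⟩ : TangentBundle I M)) := by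
    intro p
    by_cases hp : p.1 ∈ T
    · exact (hV.contMDiffAt (prod_mem_nhds (hT.mem_nhds hp) Filter.univ_mem)).smul_tangent
        (hθ.contMDiff.contMDiffAt.comp p contMDiffAt_fst)
    · have h0 := ((Bundle.contMDiff_zeroSection (n := ∞) (IB := I) (F := E) ℝ
        (TangentSpace I : M → Type _)).comp (contMDiff_snd (I := 𝓘(ℝ, ℝ)) (M := ℝ))) p
      refine h0.congr_of_eventuallyEq ?_
      filter_upwards [continuousAt_fst.preimage_mem_nhds
        ((isClosed_tsupport θ).isOpen_compl.mem_nhds fun h ↦ hp (hθT h))] with q hq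
      simp only [Function.comp_apply, Bundle.zeroSection]
      rw [image_eq_zero_of_notMem_tsupport hq, zero_smul]
  exact contMDiff_equivTangentBundleProd_symm.comp (h1.prodMk h2)

/-- The flow of a smooth time-dependent vector field on a closed manifold, for times in the unit
interval. -/
theorem exists_isotopy_of_timeDependent [FiniteDimensional ℝ E] [I.Boundaryless] [T2Space M]
    [CompactSpace M] {V : ℝ → (x : M) → TangentSpace I x} {T : Set ℝ} (hT : IsOpen T)
    (hT01 : Icc 0 1 ⊆ T)
    (hV : ContMDiffOn (𝓘(ℝ, ℝ).prod I) I.tangent ∞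
      (fun p : ℝ × M ↦ (⟨p.2, V p.1 p.2⟩ : TangentBundle I M)) (T ×ˢ univ)) :
    ∃ Φ : ℝ × M → M, ContMDiff (𝓘(ℝ, ℝ).prod I) I ∞ Φ ∧ (∀ x, Φ (0, x) = x) ∧
      (∀ t ∈ Icc (0 : ℝ) 1, ∀ x, HasMFDerivAt 𝓘(ℝ, ℝ) I (fun s ↦ Φ (s, x)) t
        ((1 : ℝ →L[ℝ] ℝ).smulRight (V t (Φ (t, x))))) ∧
      ∀ t ∈ Icc (0 : ℝ) 1, ∃ φ : M ≃ₘ^∞⟮I, I⟯ M, ∀ x, φ x = Φ (t, x) := by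
  obtain ⟨δ, hδ, hδT⟩ := isCompact_Icc.exists_cthickening_subset_open hT hT01
  have hIcc : Icc (0 : ℝ) 1 = Metric.closedBall (1 / 2) (1 / 2) := by
    rw [Real.closedBall_eq_Icc]; norm_num
  rw [hIcc, cthickening_closedBall hδ.le (by norm_num)] at hδT
  -- The radii make `θ = 1` on a neighbourhood of `[0, 1]`, the ball of centre and radius `1/2`,
  -- while its support is the closed `δ`-thickening, still inside `T`.
  let θ : ContDiffBump (1 / 2 : ℝ) := ⟨δ / 2 + 1 / 2, δ + 1 / 2, by positivity, by linarith⟩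
  have hθ1 : ∀ s ∈ Ioo (-(δ / 2)) (1 + δ / 2), θ s = 1 := fun s hs ↦ by
    refine θ.one_of_mem_closedBall ?_
    rw [Real.closedBall_eq_Icc]
    exact ⟨by change 1 / 2 - (δ / 2 + 1 / 2) ≤ s; linarith [hs.1],
      by change s ≤ 1 / 2 + (δ / 2 + 1 / 2); linarith [hs.2]⟩
  have hθT : tsupport θ ⊆ T := by rw [θ.tsupport_eq]; exact hδT
  have hw := contMDiff_suspension θ.contDiff hT hθT hV
  obtain ⟨F, hF, hF0, hFc, hFadd⟩ := exists_global_flow hw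
    (θ.hasCompactSupport.isCompact.prod (isCompact_univ (X := M))) (fun p hp ↦ by
      have : θ p.1 = 0 := image_eq_zero_of_notMem_tsupport fun h ↦ hp ⟨h, mem_univ _⟩
      simp only [suspension, this, zero_smul]
      rfl)
  have hfst : ∀ p s, HasDerivAt (fun s ↦ (F (s, p)).1) (θ (F (s, p)).1) s := fun p s ↦ by
    have h := (hasMFDerivAt_fst (I := 𝓘(ℝ, ℝ)) (I' := I) (F (s, p))).comp s (hFc p s)
    rw [hasDerivAt_iff_hasFDerivAt]
    exact hasMFDerivAt_iff_hasFDerivAt.1 h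
  -- The time coordinate solves `s' = θ(s)`. While `p.1 + s` stays where `θ = 1`, it is a solution
  -- too, and uniqueness for the Lipschitz function `θ` identifies the two.
  have htime : ∀ p : ℝ × M, p.1 ∈ Icc (0 : ℝ) 1 → ∀ s, p.1 + s ∈ Ioo (-(δ / 2)) (1 + δ / 2) →
      (F (s, p)).1 = p.1 + s := fun p hp s hs ↦ by
    obtain ⟨C, hC⟩ := θ.contDiff.lipschitzWith_of_hasCompactSupport (𝕂 := ℝ) (n := 1)
      θ.hasCompactSupport one_ne_zero
    refine ODE_solution_unique_of_mem_Ioo (v := fun _ ↦ θ) (s := fun _ ↦ univ) (t₀ := 0)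
      (a := -(δ / 2) - p.1) (b := 1 + δ / 2 - p.1) (f := fun s ↦ (F (s, p)).1)
      (g := fun s ↦ p.1 + s) (fun _ _ ↦ hC.lipschitzOnWith) ?_ (fun s _ ↦ ⟨hfst p s, mem_univ _⟩)
      (fun s hs ↦ ⟨?_, mem_univ _⟩) ?_ ?_
    · exact ⟨by linarith [hp.1], by linarith [hp.2]⟩
    · rw [hθ1 _ ⟨by linarith [hs.1], by linarith [hs.2]⟩]
      exact (hasDerivAt_id s).const_add _
    · simp [hF0]
    · exact ⟨by linarith [hs.1], by linarith [hs.2]⟩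
  have hmem : ∀ t ∈ Icc (0 : ℝ) 1, t ∈ Ioo (-(δ / 2)) (1 + δ / 2) := fun t ht ↦
    ⟨by linarith [ht.1], by linarith [ht.2]⟩
  have htime0 : ∀ t ∈ Icc (0 : ℝ) 1, ∀ x, (F (t, (0, x))).1 = t := fun t ht x ↦ by
    rw [htime (0, x) (by simp) t (by rw [zero_add]; exact hmem t ht), zero_add]
  have htime1 : ∀ t ∈ Icc (0 : ℝ) 1, ∀ x, (F (-t, (t, x))).1 = 0 := fun t ht x ↦ by
    rw [htime (t, x) ht (-t) (by rw [add_neg_cancel]; exact hmem 0 (by simp)), add_neg_cancel]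
  have hΦ : ContMDiff (𝓘(ℝ, ℝ).prod I) I ∞ (fun p : ℝ × M ↦ (F (p.1, (0, p.2))).2) :=
    contMDiff_snd.comp (hF.comp (contMDiff_fst.prodMk (contMDiff_const.prodMk contMDiff_snd)))
  refine ⟨fun p ↦ (F (p.1, (0, p.2))).2, hΦ, fun x ↦ by simp only [hF0], fun t ht x ↦ ?_, fun t ht ↦ ?_⟩
  · have h := (hasMFDerivAt_snd (I := 𝓘(ℝ, ℝ)) (I' := I) (F (t, (0, x)))).comp t (hFc (0, x) t)
    refine h.congr_mfderiv ?_
    ext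
    have hq : ∀ q : ℝ × M, q.1 = t → θ q.1 • V q.1 q.2 = V t q.2 := by
      rintro q rfl
      rw [hθ1 _ (hmem _ ht), one_smul]
    exact congrArg ((1 : ℝ) • ·) (hq (F (t, (0, x))) (htime0 t ht x))
  · have hcomp : ∀ r : ℝ, ∀ s : ℝ, ContMDiff I I ∞ (fun x ↦ (F (r, (s, x))).2) := fun r s ↦
      contMDiff_snd.comp (hF.comp (contMDiff_const.prodMk (contMDiff_const.prodMk contMDiff_id)))
    -- The inverse starts at `(t, x)` and flows for time `-t`; the additive law of the suspended
    -- flow shows that the maps are mutually inverse.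
    refine ⟨{ toFun := fun x ↦ (F (t, (0, x))).2
              invFun := fun x ↦ (F (-t, (t, x))).2
              left_inv := fun x ↦ ?_
              right_inv := fun x ↦ ?_
              contMDiff_toFun := hcomp t 0
              contMDiff_invFun := hcomp (-t) t }, fun x ↦ rfl⟩
    · have h : (t, (F (t, (0, x))).2) = F (t, (0, x)) := Prod.ext (htime0 t ht x).symm rfl
      dsimp only
      rw [h, ← hFadd, neg_add_cancel, hF0]
    · have h : (0, (F (-t, (t, x))).2) = F (-t, (t, x)) := Prod.ext (htime1 t ht x).symm rfl
      dsimp only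
      rw [h, ← hFadd, add_neg_cancel, hF0]

end TimeDependent

/-! ### Linear algebra of `a ∧ b ^ k` in top degree -/

section Wedge

variable {V : Type*} [AddCommGroup V] [Module ℝ V] {p q : ℕ}

lemma wedge_add_smul_left (a a' : V [⋀^Fin p]→ₗ[ℝ] ℝ) (c : ℝ) (b : V [⋀^Fin q]→ₗ[ℝ] ℝ) :
    wedge (a + c • a') b = wedge a b + c • wedge a' b := by
  have h : (a + c • a').domCoprod b = a.domCoprod b + c • a'.domCoprod b := by
    simp only [← AlternatingMap.domCoprod'_apply]
    rw [TensorProduct.add_tmul, ← TensorProduct.smul_tmul', map_add, map_smul]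
  unfold wedge
  rw [h]
  ext v
  simp

/-- The alternating form `a` vanishes as soon as one of its arguments is `R`. -/
def VanishesAt {ι : Type*} (R : V) (a : V [⋀^ι]→ₗ[ℝ] ℝ) : Prop :=
  ∀ v : ι → V, ∀ i, v i = R → a v = 0

/-- In each shuffle term the argument `R` is fed to one of the two factors, which kills that term.
-/
lemma VanishesAt.wedge {R : V} {a : V [⋀^Fin p]→ₗ[ℝ] ℝ} {b : V [⋀^Fin q]→ₗ[ℝ] ℝ}
    (ha : VanishesAt R a) (hb : VanishesAt R b) : VanishesAt R (wedge a b) := by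
  intro v i hi
  change LinearMap.mul' ℝ ℝ ((a.domCoprod b) (v ∘ finSumFinEquiv)) = 0
  have h : (a.domCoprod b) (v ∘ finSumFinEquiv) = 0 := by
    rw [← AlternatingMap.coe_multilinearMap, AlternatingMap.domCoprod_coe, sum_apply]
    refine Finset.sum_eq_zero fun σ _ ↦ ?_
    induction σ using Quotient.inductionOn' with
    | h σ =>
      rw [AlternatingMap.domCoprod.summand_mk'']
      simp only [smul_apply, MultilinearMap.domDomCongr_apply,
        MultilinearMap.domCoprod_apply]
      obtain ⟨j, hj⟩ : ∃ j, finSumFinEquiv (σ j) = i :=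
        ⟨σ.symm (finSumFinEquiv.symm i), by simp⟩
      rcases j with j | j
      · rw [AlternatingMap.coe_multilinearMap, ha _ j (by simp [hj, hi]), TensorProduct.zero_tmul,
          smul_zero]
      · rw [AlternatingMap.coe_multilinearMap, AlternatingMap.coe_multilinearMap,
          hb _ j (by simp [hj, hi]), TensorProduct.tmul_zero, smul_zero]
  rw [h, map_zero]

lemma VanishesAt.wedgePow {R : V} {b : V [⋀^Fin 2]→ₗ[ℝ] ℝ} (hb : VanishesAt R b) (k : ℕ) :
    VanishesAt R (wedgePow b k) := by
  induction k with
  -- The constant form `1` satisfies `VanishesAt` vacuously, having no arguments.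
  | zero => exact fun _ i ↦ i.elim0
  | succ k ih => exact ih.wedge hb

/-- An alternating form of top degree with a non-zero vector in its kernel vanishes. -/
lemma VanishesAt.eq_zero [FiniteDimensional ℝ V] {m : ℕ} (hm : Module.finrank ℝ V = m) {R : V}
    (hR : R ≠ 0) {a : V [⋀^Fin m]→ₗ[ℝ] ℝ} (ha : VanishesAt R a) : a = 0 := by
  have hli : LinearIndepOn ℝ id ({R} : Set V) := LinearIndepOn.singleton hR
  -- An injective family of `m` vectors from a basis containing `R` exhausts it, hence contains `R`;
  -- such families determine an alternating form.
  let B := Module.Basis.extend hli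
  have hfin : Fintype (hli.extend (subset_univ _)) := FiniteDimensional.fintypeBasisIndex B
  refine B.ext_alternating fun v hv ↦ ?_
  have hbij : Function.Bijective v := by
    rw [Fintype.bijective_iff_injective_and_card]
    exact ⟨hv, by rw [← Module.finrank_eq_card_basis B, hm, Fintype.card_fin]⟩
  obtain ⟨i, hi⟩ := hbij.2 ⟨R, hli.subset_extend (subset_univ _) rfl⟩
  refine ha _ i ?_
  rw [hi, Module.Basis.extend_apply_self]

lemma vanishesAt_oneForm {R : V} {a : V [⋀^Fin 1]→ₗ[ℝ] ℝ} (h : a ![R] = 0) : VanishesAt R a := by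
  intro v i hi
  have : v = ![R] := by ext j; rw [Subsingleton.elim j i, hi, Subsingleton.elim i 0]; rfl
  rw [this, h]

lemma vanishesAt_twoForm {R : V} {b : V [⋀^Fin 2]→ₗ[ℝ] ℝ} (h : ∀ u, b ![R, u] = 0) :
    VanishesAt R b := by
  intro v i hi
  have h0 : v = ![v 0, v 1] := by ext j; fin_cases j <;> rfl
  fin_cases i
  · have h1 : v 0 = R := hi
    rw [h0, h1, h]
  · have h1 : v 1 = R := hi
    have h2 : v ∘ Equiv.swap 0 1 = ![R, v 0] := by
      ext j; fin_cases j
      · exact h1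
      · rfl
    have h3 := b.map_swap v (i := 0) (j := 1) (by simp)
    rw [h2, h] at h3
    exact neg_eq_zero.1 h3.symm

lemma wedge_wedgePow_eq_zero [FiniteDimensional ℝ V] {k : ℕ} (hk : Module.finrank ℝ V = 1 + 2 * k)
    {R : V} (hR : R ≠ 0) {a : V [⋀^Fin 1]→ₗ[ℝ] ℝ} {b : V [⋀^Fin 2]→ₗ[ℝ] ℝ} (ha : a ![R] = 0)
    (hb : ∀ u, b ![R, u] = 0) : wedge a (wedgePow b k) = 0 :=
  ((vanishesAt_oneForm ha).wedge ((vanishesAt_twoForm hb).wedgePow k)).eq_zero hk hR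

/-- If `a ∧ b^k` is a volume form and `R` is in the kernel of `b`, then a one-form `a'` not
vanishing on `R` also gives a volume form `a' ∧ b^k`. -/
lemma wedge_wedgePow_ne_zero [FiniteDimensional ℝ V] {k : ℕ}
    (hk : Module.finrank ℝ V = 1 + 2 * k) {R : V} (hR : R ≠ 0) {a a' : V [⋀^Fin 1]→ₗ[ℝ] ℝ}
    {b : V [⋀^Fin 2]→ₗ[ℝ] ℝ} (hb : ∀ u, b ![R, u] = 0) (hab : wedge a (wedgePow b k) ≠ 0)
    (ha' : a' ![R] ≠ 0) : wedge a' (wedgePow b k) ≠ 0 := by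
  intro h
  -- The coefficient is chosen so that the combined one-form kills `R`; its product with `b ^ k` is
  -- then zero, making `a ∧ b ^ k` a multiple of `a' ∧ b ^ k`.
  have h0 : wedge (a + (-(a ![R] / a' ![R])) • a') (wedgePow b k) = 0 := by
    refine wedge_wedgePow_eq_zero hk hR ?_ hb
    rw [AlternatingMap.add_apply, AlternatingMap.smul_apply, smul_eq_mul, neg_mul,
      div_mul_cancel₀ _ ha', add_neg_cancel]
  rw [wedge_add_smul_left, h, smul_zero, add_zero] at h0
  exact hab h0

end Wedge

/-! ### Pointwise solution of the Moser equation -/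

section MoserPair

/-- The pair consisting of the Reeb vector `R` of `(a, w)` and the vector `X` in `ker a` such that
`ι_X w = β - β(R) a`. -/
structure IsMoserPair {T : Type*} [AddCommGroup T] [Module ℝ T] [TopologicalSpace T]
    (a : T [⋀^Fin 1]→L[ℝ] ℝ) (w : T [⋀^Fin 2]→L[ℝ] ℝ) (β : T [⋀^Fin 1]→L[ℝ] ℝ) (X R : T) :
    Prop where
  apply_reeb : a ![R] = 1
  reeb_mem_ker : ∀ u, w ![R, u] = 0
  apply_eq_zero : a ![X] = 0
  contract_eq : ∀ u, w ![X, u] = β ![u] - β ![R] * a ![u]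

/-- The one-form `a` does not vanish on non-zero vectors of the kernel of `w`. -/
def Nondegenerate {T : Type*} [AddCommGroup T] [Module ℝ T] [TopologicalSpace T]
    (a : T [⋀^Fin 1]→L[ℝ] ℝ) (w : T [⋀^Fin 2]→L[ℝ] ℝ) : Prop :=
  ∀ v, (∀ u, w ![v, u] = 0) → a ![v] = 0 → v = 0

section General

variable {T T' : Type*} [AddCommGroup T] [Module ℝ T] [TopologicalSpace T]
  [AddCommGroup T'] [Module ℝ T'] [TopologicalSpace T']

lemma oneForm_sub (a : T [⋀^Fin 1]→L[ℝ] ℝ) (x y : T) : a ![x - y] = a ![x] - a ![y] := by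
  have h := a.toMultilinearMap.cons_add ![] (x - y) y
  rw [sub_add_cancel] at h
  exact eq_sub_of_add_eq h.symm

lemma twoForm_sub_left (w : T [⋀^Fin 2]→L[ℝ] ℝ) (x y u : T) :
    w ![x - y, u] = w ![x, u] - w ![y, u] := by
  have h := w.toMultilinearMap.cons_add ![u] (x - y) y
  rw [sub_add_cancel] at h
  exact eq_sub_of_add_eq h.symm

/-- Differences of two solutions lie in the kernels of both `w` and `a`. Uniqueness lets the
intrinsic vectors be compared with those computed in a chart. -/
lemma IsMoserPair.unique {a : T [⋀^Fin 1]→L[ℝ] ℝ} {w : T [⋀^Fin 2]→L[ℝ] ℝ}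
    {β : T [⋀^Fin 1]→L[ℝ] ℝ} {X R X' R' : T} (h : IsMoserPair a w β X R)
    (h' : IsMoserPair a w β X' R') (hn : Nondegenerate a w) : X = X' ∧ R = R' := by
  have hR : R = R' := by
    refine sub_eq_zero.1 (hn _ (fun u ↦ ?_) ?_)
    · rw [twoForm_sub_left, h.reeb_mem_ker, h'.reeb_mem_ker, sub_zero]
    · rw [oneForm_sub, h.apply_reeb, h'.apply_reeb, sub_self]
  refine ⟨sub_eq_zero.1 (hn _ (fun u ↦ ?_) ?_), hR⟩
  · rw [twoForm_sub_left, h.contract_eq, h'.contract_eq, hR, sub_self]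
  · rw [oneForm_sub, h.apply_eq_zero, h'.apply_eq_zero, sub_self]

lemma compCLM_one (a : T' [⋀^Fin 1]→L[ℝ] ℝ) (f : T →L[ℝ] T') (u : T) :
    a.compContinuousLinearMap f ![u] = a ![f u] := by
  rw [ContinuousAlternatingMap.compContinuousLinearMap_apply]
  congr 1
  ext i; fin_cases i; rfl

lemma compCLM_two (a : T' [⋀^Fin 2]→L[ℝ] ℝ) (f : T →L[ℝ] T') (u v : T) :
    a.compContinuousLinearMap f ![u, v] = a ![f u, f v] := by
  rw [ContinuousAlternatingMap.compContinuousLinearMap_apply]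
  congr 1
  ext i; fin_cases i <;> rfl

lemma IsMoserPair.map {a : T' [⋀^Fin 1]→L[ℝ] ℝ} {w : T' [⋀^Fin 2]→L[ℝ] ℝ}
    {β : T' [⋀^Fin 1]→L[ℝ] ℝ} {f : T →L[ℝ] T'} (hf : Function.Surjective f) {X R : T}
    (h : IsMoserPair (a.compContinuousLinearMap f) (w.compContinuousLinearMap f)
      (β.compContinuousLinearMap f) X R) : IsMoserPair a w β (f X) (f R) where
  apply_reeb := by rw [← compCLM_one, h.apply_reeb]
  reeb_mem_ker u := by
    obtain ⟨u, rfl⟩ := hf u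
    rw [← compCLM_two, h.reeb_mem_ker]
  apply_eq_zero := by rw [← compCLM_one, h.apply_eq_zero]
  contract_eq u := by
    obtain ⟨u, rfl⟩ := hf u
    rw [← compCLM_two, h.contract_eq, compCLM_one, compCLM_one, compCLM_one]

lemma nondegenerate_comp_iff {a : T' [⋀^Fin 1]→L[ℝ] ℝ} {w : T' [⋀^Fin 2]→L[ℝ] ℝ}
    {f : T →L[ℝ] T'} (hf : Function.Bijective f) :
    Nondegenerate (a.compContinuousLinearMap f) (w.compContinuousLinearMap f) ↔
      Nondegenerate a w := by
  constructor
  · intro h v hv1 hv2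
    obtain ⟨v, rfl⟩ := hf.2 v
    rw [h v (fun u ↦ by rw [compCLM_two, hv1]) (by rw [compCLM_one, hv2]), map_zero]
  · intro h v hv1 hv2
    refine hf.1 ((h (f v) (fun u ↦ ?_) ?_).trans (map_zero f).symm)
    · obtain ⟨u, rfl⟩ := hf.2 u
      rw [← compCLM_two, hv1]
    · rw [← compCLM_one, hv2]

end General

variable {E : Type*} [NormedAddCommGroup E] [NormedSpace ℝ E]

/-- Alternating one-forms as covectors. -/
def toCovector (E : Type*) [NormedAddCommGroup E] [NormedSpace ℝ E] :
    (E [⋀^Fin 1]→L[ℝ] ℝ) ≃ₗᵢ[ℝ] (E →L[ℝ] ℝ) :=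
  (ContinuousAlternatingMap.ofSubsingletonLIE (𝕜 := ℝ) (E := E) (F := ℝ) (0 : Fin 1)).symm

lemma toCovector_apply (a : E [⋀^Fin 1]→L[ℝ] ℝ) (v : E) : toCovector E a v = a ![v] := by
  change a (fun _ ↦ v) = a ![v]
  congr 1
  ext i; fin_cases i; rfl

lemma contDiff_toCovector {n : WithTop ℕ∞} : ContDiff ℝ n (toCovector E) :=
  (toCovector E).contDiff

/-- Alternating two-forms as bilinear maps. -/
def toBilin (w : E [⋀^Fin 2]→L[ℝ] ℝ) : E →L[ℝ] E →L[ℝ] ℝ :=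
  LinearMap.mkContinuous (E := E) (F := E →L[ℝ] ℝ)
    { toFun := fun u ↦ toCovector E (w.curryLeft u)
      map_add' := fun u v ↦ by rw [map_add, map_add]
      map_smul' := fun c u ↦ by rw [map_smul, map_smul]; rfl } ‖w‖ fun u ↦ by
    refine le_of_eq_of_le ((toCovector E).norm_map _) ?_
    rw [← w.norm_curryLeft]
    exact w.curryLeft.le_opNorm u

lemma toBilin_apply (w : E [⋀^Fin 2]→L[ℝ] ℝ) (u v : E) : toBilin w u v = w ![u, v] :=
  toCovector_apply (w.curryLeft u) v

lemma contDiff_toBilin {n : WithTop ℕ∞} :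
    ContDiff ℝ n (fun w : E [⋀^Fin 2]→L[ℝ] ℝ ↦ toBilin w) := by
  refine IsBoundedLinearMap.contDiff
    { map_add := fun w w' ↦ ?_, map_smul := fun c w ↦ ?_, bound := ⟨1, one_pos, fun w ↦ ?_⟩ }
  · ext u v
    simp [toBilin_apply]
  · ext u v
    simp [toBilin_apply]
  · rw [one_mul]
    exact LinearMap.mkContinuous_norm_le _ (norm_nonneg w) _

/-- The operator `v ↦ ι_v w + a(v) a`. -/
def moserOperator (a : E [⋀^Fin 1]→L[ℝ] ℝ) (w : E [⋀^Fin 2]→L[ℝ] ℝ) : E →L[ℝ] E →L[ℝ] ℝ :=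
  toBilin w + (toCovector E a).smulRight (toCovector E a)

lemma moserOperator_apply (a : E [⋀^Fin 1]→L[ℝ] ℝ) (w : E [⋀^Fin 2]→L[ℝ] ℝ) (u v : E) :
    moserOperator a w u v = w ![u, v] + a ![u] * a ![v] := by
  simp [moserOperator, toBilin_apply, toCovector_apply]

/-- The Reeb vector of `(a, w)`. -/
def reebVector (a : E [⋀^Fin 1]→L[ℝ] ℝ) (w : E [⋀^Fin 2]→L[ℝ] ℝ) : E :=
  (moserOperator a w).inverse (toCovector E a)

/-- The vector `X` in `ker a` such that `ι_X w = β - β(R) a`. -/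
def moserVector (a : E [⋀^Fin 1]→L[ℝ] ℝ) (w : E [⋀^Fin 2]→L[ℝ] ℝ) (β : E [⋀^Fin 1]→L[ℝ] ℝ) : E :=
  (moserOperator a w).inverse (toCovector E β) -
    toCovector E a ((moserOperator a w).inverse (toCovector E β)) • reebVector a w

/-- Invertibility is an open condition on operators, so this converse spreads nondegeneracy to
nearby points. -/
lemma nondegenerate_of_isInvertible {a : E [⋀^Fin 1]→L[ℝ] ℝ} {w : E [⋀^Fin 2]→L[ℝ] ℝ}
    (h : (moserOperator a w).IsInvertible) : Nondegenerate a w := by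
  intro v h1 h2
  refine h.injective ?_
  ext u
  rw [moserOperator_apply, h1, h2]
  simp

variable [FiniteDimensional ℝ E]

/-- If `ι_v w + a(v) a = 0`, evaluating at `R` gives `a(v) = 0`, then `ι_v w = 0`, so `v = 0`.
Injectivity suffices because a space and its dual have equal dimension. -/
lemma isInvertible_moserOperator {a : E [⋀^Fin 1]→L[ℝ] ℝ} {w : E [⋀^Fin 2]→L[ℝ] ℝ}
    (h : Nondegenerate a w) {R : E} (hR : R ≠ 0) (hRw : ∀ u, w ![R, u] = 0) :
    (moserOperator a w).IsInvertible := by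
  have haR : a ![R] ≠ 0 := fun h0 ↦ hR (h R hRw h0)
  have hwR : ∀ u, w ![u, R] = 0 := fun u ↦ vanishesAt_twoForm (b := w.toAlternatingMap) hRw ![u, R] 1 rfl
  have hinj : Function.Injective (moserOperator a w) := by
    refine (injective_iff_map_eq_zero _).2 fun v hv ↦ ?_
    have hv' : ∀ u, w ![v, u] + a ![v] * a ![u] = 0 := fun u ↦ by
      rw [← moserOperator_apply, hv]; rfl
    have h1 : a ![v] = 0 := by
      have := hv' R
      rw [hwR, zero_add] at this
      exact (mul_eq_zero.1 this).resolve_right haR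
    refine h v (fun u ↦ ?_) h1
    have := hv' u
    rwa [h1, zero_mul, add_zero] at this
  have hdim : Module.finrank ℝ E = Module.finrank ℝ (E →L[ℝ] ℝ) := by
    rw [← (LinearMap.toContinuousLinearMap (𝕜 := ℝ) (E := E) (F' := ℝ)).finrank_eq]
    exact Subspace.dual_finrank_eq.symm
  exact ⟨(LinearEquiv.ofInjectiveOfFinrankEq (moserOperator a w : E →ₗ[ℝ] E →L[ℝ] ℝ) hinj
    hdim).toContinuousLinearEquiv, rfl⟩

lemma isMoserPair_moserVector {a : E [⋀^Fin 1]→L[ℝ] ℝ} {w : E [⋀^Fin 2]→L[ℝ] ℝ}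
    (β : E [⋀^Fin 1]→L[ℝ] ℝ) (h : Nondegenerate a w) {R : E} (hR : R ≠ 0)
    (hRw : ∀ u, w ![R, u] = 0) : IsMoserPair a w β (moserVector a w β) (reebVector a w) := by
  have hinv := isInvertible_moserOperator h hR hRw
  have haR : a ![R] ≠ 0 := fun h0 ↦ hR (h R hRw h0)
  have hwR : ∀ u, w ![u, R] = 0 := fun u ↦ vanishesAt_twoForm (b := w.toAlternatingMap) hRw ![u, R] 1 rfl
  have key : ∀ γ : E [⋀^Fin 1]→L[ℝ] ℝ, ∀ u,
      w ![(moserOperator a w).inverse (toCovector E γ), u] +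
        a ![(moserOperator a w).inverse (toCovector E γ)] * a ![u] = γ ![u] := fun γ u ↦ by
    rw [← moserOperator_apply, hinv.self_apply_inverse, toCovector_apply]
  have hreeb1 : a ![reebVector a w] = 1 := by
    have := key a R
    rw [hwR, zero_add] at this
    exact mul_right_cancel₀ haR (this.trans (one_mul _).symm)
  have hreeb2 : ∀ u, w ![reebVector a w, u] = 0 := fun u ↦ by
    have := key a u
    change w ![reebVector a w, u] + a ![reebVector a w] * a ![u] = a ![u] at this
    rw [hreeb1, one_mul] at this
    linarith
  have hwr : ∀ u, w ![u, reebVector a w] = 0 := fun u ↦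
    vanishesAt_twoForm (b := w.toAlternatingMap) hreeb2 ![u, reebVector a w] 1 rfl
  have hsmul : ∀ (c : ℝ) (v : E), a ![c • v] = c * a ![v] := fun c v ↦ by
    rw [← toCovector_apply, map_smul, toCovector_apply, smul_eq_mul]
  -- Evaluation at the Reeb vector gives `a(Y) = β(R)` for the preimage `Y` of `β`. Subtracting
  -- `a(Y) R` then lands in `ker a` without changing `ι_Y w`.
  have hY := key β (reebVector a w)
  rw [hwr, zero_add, hreeb1, mul_one] at hY
  refine ⟨hreeb1, hreeb2, ?_, fun u ↦ ?_⟩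
  · rw [moserVector, oneForm_sub, hsmul, hreeb1, mul_one, toCovector_apply, sub_self]
  · have h1 := key β u
    rw [hY] at h1
    rw [moserVector, twoForm_sub_left, ← toBilin_apply w (_ • _), map_smul,
      smul_apply, toBilin_apply, hreeb2, smul_zero, sub_zero]
    linarith

section Smoothness

variable {P : Type*} [NormedAddCommGroup P] [NormedSpace ℝ P] {n : WithTop ℕ∞}
  {a β : P → E [⋀^Fin 1]→L[ℝ] ℝ} {w : P → E [⋀^Fin 2]→L[ℝ] ℝ} {p : P}

omit [FiniteDimensional ℝ E] in
lemma contDiffAt_toCovector (ha : ContDiffAt ℝ n a p) :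
    ContDiffAt ℝ n (fun q ↦ toCovector E (a q)) p :=
  contDiff_toCovector.contDiffAt.comp p ha

omit [FiniteDimensional ℝ E] in
lemma contDiffAt_moserOperator (ha : ContDiffAt ℝ n a p) (hw : ContDiffAt ℝ n w p) :
    ContDiffAt ℝ n (fun q ↦ moserOperator (a q) (w q)) p := by
  have h1 : ContDiffAt ℝ n (fun q ↦ toBilin (w q)) p :=
    contDiff_toBilin.contDiffAt.comp p hw
  have h2 : ContDiffAt ℝ n (fun q ↦ (toCovector E (a q)).smulRight (toCovector E (a q))) p :=
    (contDiffAt_toCovector ha).smulRight (contDiffAt_toCovector ha)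
  exact h1.add h2

lemma contDiffAt_inverse_moserOperator (ha : ContDiffAt ℝ n a p) (hw : ContDiffAt ℝ n w p)
    (hβ : ContDiffAt ℝ n β p) (hinv : (moserOperator (a p) (w p)).IsInvertible) :
    ContDiffAt ℝ n (fun q ↦ (moserOperator (a q) (w q)).inverse (toCovector E (β q))) p := by
  have : CompleteSpace E := FiniteDimensional.complete ℝ E
  have h : ContDiffAt ℝ n (fun q ↦ (moserOperator (a q) (w q)).inverse) p :=
    ContDiffAt.comp p (g := ContinuousLinearMap.inverse) hinv.contDiffAt_map_inverse
      (contDiffAt_moserOperator ha hw)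
  exact h.clm_apply (contDiffAt_toCovector hβ)

lemma contDiffAt_reebVector (ha : ContDiffAt ℝ n a p) (hw : ContDiffAt ℝ n w p)
    (hinv : (moserOperator (a p) (w p)).IsInvertible) :
    ContDiffAt ℝ n (fun q ↦ reebVector (a q) (w q)) p :=
  contDiffAt_inverse_moserOperator ha hw ha hinv

lemma contDiffAt_moserVector (ha : ContDiffAt ℝ n a p) (hw : ContDiffAt ℝ n w p)
    (hβ : ContDiffAt ℝ n β p) (hinv : (moserOperator (a p) (w p)).IsInvertible) :
    ContDiffAt ℝ n (fun q ↦ moserVector (a q) (w q) (β q)) p := by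
  have h := contDiffAt_inverse_moserOperator ha hw hβ hinv
  unfold moserVector
  exact h.sub (((contDiffAt_toCovector ha).clm_apply h).smul (contDiffAt_reebVector ha hw hinv))

end Smoothness

end MoserPair

/-! ### Differential forms in charts: pullback and exterior derivative -/

section Forms

variable {d : ℕ} {M : Type*} [TopologicalSpace M] [ChartedSpace (EuclideanSpace ℝ (Fin d)) M]

namespace DForm

variable {k : ℕ}

/-- All tangent spaces are definitionally the model space, so the same vectors can be used at two
equal base points without transport. -/
lemma apply_congr_point (α : DForm d M k) {x y : M} (h : x = y)
    (w : Fin k → EuclideanSpace ℝ (Fin d)) : (α x w : ℝ) = α y w := by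
  subst h; rfl

lemma inChart_add (α β : DForm d M k) (x₀ : M) :
    (α + β).inChart x₀ = α.inChart x₀ + β.inChart x₀ := rfl

lemma inChart_smul (c : ℝ) (α : DForm d M k) (x₀ : M) :
    (c • α).inChart x₀ = c • α.inChart x₀ := rfl

variable {α β : DForm d M k}

lemma IsSmooth.add (hα : α.IsSmooth) (hβ : β.IsSmooth) : (α + β).IsSmooth :=
  fun x₀ ↦ (hα x₀).add (hβ x₀)

lemma IsSmooth.const_smul (c : ℝ) (hα : α.IsSmooth) : (c • α).IsSmooth :=
  fun x₀ ↦ (hα x₀).const_smul c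

lemma IsSmooth.contDiffAt (hα : α.IsSmooth) {x₀ : M} {y : EuclideanSpace ℝ (Fin d)}
    (hy : y ∈ (extChartAt (𝓡 d) x₀).target) : ContDiffAt ℝ ∞ (α.inChart x₀) y :=
  (hα x₀).contDiffAt ((isOpen_extChartAt_target x₀).mem_nhds hy)

lemma IsSmooth.differentiableAt_self (hα : α.IsSmooth) (x : M) :
    DifferentiableAt ℝ (α.inChart x) (extChartAt (𝓡 d) x x) :=
  (hα.contDiffAt (mem_extChartAt_target x)).differentiableAt (by simp)

lemma extd_add (hα : α.IsSmooth) (hβ : β.IsSmooth) : (α + β).extd = α.extd + β.extd := by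
  funext x
  unfold extd
  rw [inChart_add, extDeriv_add (hα.differentiableAt_self x) (hβ.differentiableAt_self x)]
  rfl

lemma extd_smul (c : ℝ) (α : DForm d M k) : (c • α).extd = c • α.extd := by
  funext x
  unfold extd
  rw [inChart_smul, extDeriv_smul]
  rfl

lemma pullback_pullback_of_involutive {f : M → M} (hf : ContMDiff (𝓡 d) (𝓡 d) ∞ f)
    (hinv : Function.Involutive f) (α : DForm d M k) : pullback f (pullback f α) = α := by
  funext x
  ext w
  have h1 := mfderiv_comp x ((hf (f x)).mdifferentiableAt (by simp))
    ((hf x).mdifferentiableAt (by simp))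
  rw [hinv.comp_self, mfderiv_id] at h1
  refine Eq.trans ?_ (apply_congr_point α (hinv x) w)
  exact congrArg (α (f (f x))) (funext fun i ↦
    congrArg (fun L : EuclideanSpace ℝ (Fin d) →L[ℝ] EuclideanSpace ℝ (Fin d) ↦ L (w i)) h1.symm)

lemma mem_ker_one {α : DForm d M 1} {x : M} {v : TangentSpace (𝓡 d) x} :
    v ∈ α.ker x ↔ α x ![v] = 0 := by
  constructor
  · intro h
    exact congrArg (fun L : (TangentSpace (𝓡 d) x) [⋀^Fin 0]→ₗ[ℝ] ℝ ↦ L ![]) h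
  · intro h
    refine LinearMap.mem_ker.2 (AlternatingMap.ext fun w ↦ ?_)
    rw [Subsingleton.elim w ![]]
    exact h

lemma mem_ker_two {α : DForm d M 2} {x : M} {v : TangentSpace (𝓡 d) x} :
    v ∈ α.ker x ↔ ∀ u, α x ![v, u] = 0 := by
  constructor
  · intro h u
    exact congrArg (fun L : (TangentSpace (𝓡 d) x) [⋀^Fin 1]→ₗ[ℝ] ℝ ↦ L ![u]) h
  · intro h
    refine LinearMap.mem_ker.2 (AlternatingMap.ext fun w ↦ ?_)
    have : w = ![w 0] := by ext j; rw [Subsingleton.elim j 0]; rfl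
    rw [this]
    exact h _

variable [IsManifold (𝓡 d) ∞ M]

lemma mdifferentiableAt_extChartAt_symm {x₀ : M} {y : EuclideanSpace ℝ (Fin d)}
    (hy : y ∈ (extChartAt (𝓡 d) x₀).target) :
    MDifferentiableAt 𝓘(ℝ, EuclideanSpace ℝ (Fin d)) (𝓡 d) (extChartAt (𝓡 d) x₀).symm y :=
  ((contMDiffOn_extChartAt_symm (n := ∞) x₀).contMDiffAt
    ((isOpen_extChartAt_target x₀).mem_nhds hy)).mdifferentiableAt (by simp)

/-- A form can be computed from its expression in a chart. -/
lemma apply_eq_inChart (α : DForm d M k) {x₀ x : M} (hx : x ∈ (chartAt (EuclideanSpace ℝ (Fin d)) x₀).source)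
    (w : Fin k → TangentSpace (𝓡 d) x) :
    (α x w : ℝ) = α.inChart x₀ (extChartAt (𝓡 d) x₀ x) (fun i ↦
      mfderiv (𝓡 d) 𝓘(ℝ, EuclideanSpace ℝ (Fin d)) (extChartAt (𝓡 d) x₀) x (w i)) := by
  have hx' : x ∈ (extChartAt (𝓡 d) x₀).source := by rwa [extChartAt_source]
  have h1 := mfderivWithin_extChartAt_symm_comp_mfderiv_extChartAt' (I := 𝓡 d) hx'
  rw [ModelWithCorners.range_eq_univ, mfderivWithin_univ] at h1
  have h2 : ∀ i, mfderiv 𝓘(ℝ, EuclideanSpace ℝ (Fin d)) (𝓡 d) (extChartAt (𝓡 d) x₀).symm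
      (extChartAt (𝓡 d) x₀ x) (mfderiv (𝓡 d) 𝓘(ℝ, EuclideanSpace ℝ (Fin d))
        (extChartAt (𝓡 d) x₀) x (w i)) = w i := fun i ↦
    congrArg (fun L : EuclideanSpace ℝ (Fin d) →L[ℝ] EuclideanSpace ℝ (Fin d) ↦ L (w i)) h1
  refine (apply_congr_point α ((extChartAt (𝓡 d) x₀).left_inv hx').symm w).trans ?_
  change _ = α ((extChartAt (𝓡 d) x₀).symm (extChartAt (𝓡 d) x₀ x)) (fun i ↦ mfderiv _ _ _ _ _)
  exact congrArg _ (funext fun i ↦ (h2 i).symm)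

lemma compCLM_mfderiv_extChartAt (α : DForm d M k) {x₀ x : M} (hx : x ∈ (chartAt (EuclideanSpace ℝ (Fin d)) x₀).source) :
    (α.inChart x₀ (extChartAt (𝓡 d) x₀ x)).compContinuousLinearMap
      (mfderiv (𝓡 d) 𝓘(ℝ, EuclideanSpace ℝ (Fin d)) (extChartAt (𝓡 d) x₀) x) = α x :=
  ContinuousAlternatingMap.ext fun w ↦ (apply_eq_inChart α hx w).symm

variable {E' : Type*} [NormedAddCommGroup E'] [NormedSpace ℝ E']
  {H' : Type*} [TopologicalSpace H'] {J : ModelWithCorners ℝ E' H'}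
  {P : Type*} [TopologicalSpace P] [ChartedSpace H' P]

lemma apply_mfderiv_eq_inChart (α : DForm d M k) {g : P → M} {p : P} {x₀ : M}
    (hg : MDifferentiableAt J (𝓡 d) g p) (hx : g p ∈ (chartAt (EuclideanSpace ℝ (Fin d)) x₀).source)
    (w : Fin k → TangentSpace J p) :
    (α (g p) (fun i ↦ mfderiv J (𝓡 d) g p (w i)) : ℝ) =
      α.inChart x₀ (extChartAt (𝓡 d) x₀ (g p)) (fun i ↦
        mfderiv J 𝓘(ℝ, EuclideanSpace ℝ (Fin d)) (extChartAt (𝓡 d) x₀ ∘ g) p (w i)) := by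
  rw [apply_eq_inChart α hx, mfderiv_comp p (mdifferentiableAt_extChartAt hx) hg]
  rfl

section Pullback

variable {f : M → M} (hf : ContMDiff (𝓡 d) (𝓡 d) ∞ f)
include hf

lemma contDiffAt_chart_comp {x₀ x₁ : M} {y : EuclideanSpace ℝ (Fin d)}
    (hy : y ∈ (extChartAt (𝓡 d) x₀).target)
    (hx : f ((extChartAt (𝓡 d) x₀).symm y) ∈ (chartAt (EuclideanSpace ℝ (Fin d)) x₁).source) :
    ContDiffAt ℝ ∞ (extChartAt (𝓡 d) x₁ ∘ f ∘ (extChartAt (𝓡 d) x₀).symm) y := by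
  rw [← contMDiffAt_iff_contDiffAt]
  exact (contMDiffAt_extChartAt' hx).comp y (hf.contMDiffAt.comp y
    ((contMDiffOn_extChartAt_symm x₀).contMDiffAt ((isOpen_extChartAt_target x₀).mem_nhds hy)))

lemma inChart_pullback (α : DForm d M k) {x₀ x₁ : M} {y : EuclideanSpace ℝ (Fin d)}
    (hy : y ∈ (extChartAt (𝓡 d) x₀).target)
    (hx : f ((extChartAt (𝓡 d) x₀).symm y) ∈ (chartAt (EuclideanSpace ℝ (Fin d)) x₁).source) :
    (pullback f α).inChart x₀ y =
      (α.inChart x₁ ((extChartAt (𝓡 d) x₁ ∘ f ∘ (extChartAt (𝓡 d) x₀).symm)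
        y)).compContinuousLinearMap
          (fderiv ℝ (extChartAt (𝓡 d) x₁ ∘ f ∘ (extChartAt (𝓡 d) x₀).symm) y) := by
  ext w
  have h1 := mdifferentiableAt_extChartAt_symm hy
  have h2 := (hf ((extChartAt (𝓡 d) x₀).symm y)).mdifferentiableAt (by simp)
  have h3 := apply_mfderiv_eq_inChart α (h2.comp y h1) hx w
  rw [mfderiv_comp y h2 h1, mfderiv_eq_fderiv] at h3
  exact h3

lemma eventually_inChart_pullback (α : DForm d M k) {x₀ x₁ : M} {y : EuclideanSpace ℝ (Fin d)}
    (hy : y ∈ (extChartAt (𝓡 d) x₀).target)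
    (hx : f ((extChartAt (𝓡 d) x₀).symm y) ∈ (chartAt (EuclideanSpace ℝ (Fin d)) x₁).source) :
    (pullback f α).inChart x₀ =ᶠ[𝓝 y] fun y ↦
      (α.inChart x₁ ((extChartAt (𝓡 d) x₁ ∘ f ∘ (extChartAt (𝓡 d) x₀).symm)
        y)).compContinuousLinearMap
          (fderiv ℝ (extChartAt (𝓡 d) x₁ ∘ f ∘ (extChartAt (𝓡 d) x₀).symm) y) := by
  have h1 : ContinuousAt (f ∘ (extChartAt (𝓡 d) x₀).symm) y :=
    hf.continuous.continuousAt.comp (mdifferentiableAt_extChartAt_symm hy).continuousAt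
  filter_upwards [(isOpen_extChartAt_target x₀).mem_nhds hy,
    h1.preimage_mem_nhds ((chartAt (EuclideanSpace ℝ (Fin d)) x₁).open_source.mem_nhds hx)] with z hz1 hz2
  exact inChart_pullback hf α hz1 hz2

/-- Naturality holds on the model space. The two sides use the preferred charts at `x` and at `f x`,
and the chain-rule identity `hd` reconciles them. -/
lemma extd_pullback {α : DForm d M k} (hα : α.IsSmooth) :
    (pullback f α).extd = pullback f α.extd := by
  funext x
  have hy := mem_extChartAt_target (I := 𝓡 d) x
  have hsx : (extChartAt (𝓡 d) x).symm (extChartAt (𝓡 d) x x) = x := extChartAt_to_inv x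
  have hx : f ((extChartAt (𝓡 d) x).symm (extChartAt (𝓡 d) x x)) ∈
      (chartAt (EuclideanSpace ℝ (Fin d)) (f x)).source := by
    rw [hsx]; exact mem_chart_source _ _
  have hfy : (extChartAt (𝓡 d) (f x) ∘ f ∘ (extChartAt (𝓡 d) x).symm) (extChartAt (𝓡 d) x x) =
    extChartAt (𝓡 d) (f x) (f x) := by simp
  have hsm := contDiffAt_chart_comp hf hy hx
  have hd : (fderiv ℝ (extChartAt (𝓡 d) (f x) ∘ f ∘ (extChartAt (𝓡 d) x).symm)
      (extChartAt (𝓡 d) x x)).comp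
        (mfderiv (𝓡 d) 𝓘(ℝ, EuclideanSpace ℝ (Fin d)) (extChartAt (𝓡 d) x) x) =
      (mfderiv (𝓡 d) 𝓘(ℝ, EuclideanSpace ℝ (Fin d)) (extChartAt (𝓡 d) (f x)) (f x)).comp
        (mfderiv (𝓡 d) (𝓡 d) f x) := by
    rw [← mfderiv_comp x (mdifferentiableAt_extChartAt (mem_chart_source _ _))
      ((hf x).mdifferentiableAt (by simp)), ← mfderiv_eq_fderiv]
    refine (mfderiv_comp x (hsm.differentiableAt (by simp)).mdifferentiableAt
      (mdifferentiableAt_extChartAt (mem_chart_source _ _))).symm.trans ?_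
    refine Filter.EventuallyEq.mfderiv_eq ?_
    filter_upwards [extChartAt_source_mem_nhds (I := 𝓡 d) x] with z hz
    simp only [Function.comp_apply, (extChartAt (𝓡 d) x).left_inv hz]
  unfold extd
  rw [(eventually_inChart_pullback hf α hy hx).extDeriv_eq, extDeriv_pullback (r := 2) (by
    rw [hfy]; exact hα.differentiableAt_self _) (hsm.of_le (WithTop.coe_le_coe.2 le_top)) (by simp), hfy]
  ext w
  exact congrArg (extDeriv (α.inChart (f x)) (extChartAt (𝓡 d) (f x) (f x))) (funext fun i ↦
    congrArg (fun L : EuclideanSpace ℝ (Fin d) →L[ℝ] EuclideanSpace ℝ (Fin d) ↦ L (w i)) hd)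

/-- In degree one, pullback is composition of a covector with a derivative, so smoothness follows
from that of composition of linear maps. -/
lemma IsSmooth.pullback {α : DForm d M 1} (hα : α.IsSmooth) : (pullback f α).IsSmooth := by
  intro x₀ y hy
  have hx : f ((extChartAt (𝓡 d) x₀).symm y) ∈ (chartAt (EuclideanSpace ℝ (Fin d))
    (f ((extChartAt (𝓡 d) x₀).symm y))).source := mem_chart_source _ _
  refine ContDiffAt.contDiffWithinAt (ContDiffAt.congr_of_eventuallyEq ?_
    (eventually_inChart_pullback hf α hy hx))
  have h1 := contDiffAt_chart_comp hf hy hx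
  have h2 := contDiffAt_toCovector (ContDiffAt.comp y (hα.contDiffAt
    ((extChartAt (𝓡 d) _).map_source (by rw [extChartAt_source]; exact hx))) h1)
  have h3 := h2.clm_comp (h1.fderiv_right (m := ∞) (by simp))
  refine ((toCovector _).symm.contDiff.contDiffAt.comp y h3).congr_of_eventuallyEq
    (Filter.Eventually.of_forall fun z ↦ ?_)
  refine (toCovector _).injective (Eq.trans ?_ ((toCovector _).apply_symm_apply _).symm)
  ext v
  refine (toCovector_apply _ v).trans ((compCLM_one _ _ v).trans ?_)
  exact (toCovector_apply _ _).symm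

end Pullback

end DForm

end Forms

/-! ### The sign argument and the linear path of contact forms -/

section RealHamiltonian

lemma oneForm_smul {T : Type*} [AddCommGroup T] [Module ℝ T] [TopologicalSpace T]
    (a : T [⋀^Fin 1]→L[ℝ] ℝ) (c : ℝ) (x : T) : a ![c • x] = c * a ![x] :=
  a.toMultilinearMap.cons_smul ![] c x

variable {d : ℕ} {M : Type*} [TopologicalSpace M] [ChartedSpace (EuclideanSpace ℝ (Fin d)) M]
  {ρ : M → M} {l : DForm d M 1} {Ω : DForm d M 2}

lemma linearPath_eq_add (ρ : M → M) (l : DForm d M 1) (t : ℝ) :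
    linearPath ρ l t = (1 - t) • l + (-t) • DForm.pullback ρ l := by
  funext x
  ext w
  change (1 - t) * l x w - t * DForm.pullback ρ l x w =
    (1 - t) * l x w + -t * DForm.pullback ρ l x w
  ring

lemma linearPath_zero (ρ : M → M) (l : DForm d M 1) : linearPath ρ l 0 = l := by
  simp [linearPath]

lemma linearPath_half (ρ : M → M) (l : DForm d M 1) :
    linearPath ρ l (1 / 2) = antisymmetrization ρ l := by
  rw [linearPath, antisymmetrization, smul_sub]
  norm_num

lemma linearPath_apply (ρ : M → M) (l : DForm d M 1) (t : ℝ) (x : M)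
    (v : TangentSpace (𝓡 d) x) :
    linearPath ρ l t x ![v] = (1 - t) * l x ![v] - t * DForm.pullback ρ l x ![v] := rfl

lemma pullback_antisymmetrization (h : DForm.pullback ρ (DForm.pullback ρ l) = l) :
    DForm.pullback ρ (antisymmetrization ρ l) = -antisymmetrization ρ l := by
  have h1 : DForm.pullback ρ (antisymmetrization ρ l) =
      (1 / 2 : ℝ) • (DForm.pullback ρ l - DForm.pullback ρ (DForm.pullback ρ l)) := rfl
  rw [h1, h]
  funext x
  ext w
  change (1 / 2 : ℝ) * (DForm.pullback ρ l x w - l x w) =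
    -((1 / 2 : ℝ) * (l x w - DForm.pullback ρ l x w))
  ring

instance instFiniteDimensionalTangentSpace (x : M) :
    FiniteDimensional ℝ (TangentSpace (𝓡 d) x) :=
  inferInstanceAs (FiniteDimensional ℝ (EuclideanSpace ℝ (Fin d)))

lemma finrank_tangentSpace (x : M) : Module.finrank ℝ (TangentSpace (𝓡 d) x) = d :=
  finrank_euclideanSpace_fin (𝕜 := ℝ)

/-- A contact form does not vanish on the non-zero vectors of `ker Ω`. -/
lemma IsContactForm.apply_ne_zero {n : ℕ} (hd : d = 1 + 2 * (n - 1)) (hl : IsContactForm n Ω l)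
    {x : M} {v : TangentSpace (𝓡 d) x} (hv : v ≠ 0) (hk : v ∈ Ω.ker x) : l x ![v] ≠ 0 := fun h ↦
  hl.wedge_ne_zero x (wedge_wedgePow_eq_zero ((finrank_tangentSpace x).trans hd) hv h
    (DForm.mem_ker_two.1 hk))

lemma exists_ne_zero_mem_ker (hΩ : ∀ x, Module.finrank ℝ (Ω.ker x) = 1) (x : M) :
    ∃ v : TangentSpace (𝓡 d) x, v ≠ 0 ∧ v ∈ Ω.ker x := by
  have : Nontrivial (Ω.ker x) := Module.nontrivial_of_finrank_pos (R := ℝ) (by rw [hΩ]; exact one_pos)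
  obtain ⟨v, hv⟩ := exists_ne (0 : Ω.ker x)
  exact ⟨v, fun h ↦ hv (Subtype.ext h), v.2⟩

/-- `v` is a positive vector for the orientation `o`. -/
def KerOrientation.IsPositive [IsManifold (𝓡 d) ∞ M] (o : KerOrientation Ω) {x : M}
    (v : TangentSpace (𝓡 d) x) : Prop :=
  ∃ (hv : v ∈ Ω.ker x) (h0 : (⟨v, hv⟩ : Ω.ker x) ≠ 0), rayOfNeZero ℝ (⟨v, hv⟩ : Ω.ker x) h0 = o.ray x

namespace KerOrientation

variable [IsManifold (𝓡 d) ∞ M] {o : KerOrientation Ω}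

lemma IsPositive.mem_ker {x : M} {v : TangentSpace (𝓡 d) x} (hv : o.IsPositive v) :
    v ∈ Ω.ker x := hv.1

lemma IsPositive.ne_zero {x : M} {v : TangentSpace (𝓡 d) x} (hv : o.IsPositive v) : v ≠ 0 :=
  fun h ↦ hv.2.1 (Subtype.ext h)

lemma exists_isPositive (o : KerOrientation Ω) (x : M) :
    ∃ v : TangentSpace (𝓡 d) x, o.IsPositive v := by
  obtain ⟨U, hU, X, -, hX⟩ := o.locally_spanned x
  obtain ⟨h1, h2, h3⟩ := hX x (mem_of_mem_nhds hU)
  exact ⟨X x, h1, h2, h3.symm⟩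

lemma IsPositive.exists_smul_eq {x : M} {v w : TangentSpace (𝓡 d) x} (hv : o.IsPositive v)
    (hw : o.IsPositive w) : ∃ c : ℝ, 0 < c ∧ w = c • v := by
  obtain ⟨hv1, hv2, hv3⟩ := hv
  obtain ⟨hw1, hw2, hw3⟩ := hw
  obtain ⟨c, hc, h⟩ := ((ray_eq_iff hv2 hw2).1 (hv3.trans hw3.symm)).exists_pos_left hv2 hw2
  exact ⟨c, hc, congrArg Subtype.val h.symm⟩

lemma isPositive_neg_of_reversed (ho : o.IsReversedBy ρ) {x : M} {v : TangentSpace (𝓡 d) x}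
    (hv : o.IsPositive v) : o.IsPositive (-(mfderiv (𝓡 d) (𝓡 d) ρ x v)) := by
  obtain ⟨hv1, hv2, hv3⟩ := hv
  obtain ⟨hw, h0, h⟩ := ho x ⟨v, hv1⟩ hv2 hv3
  refine ⟨neg_mem hw, neg_ne_zero.2 h0, ?_⟩
  rw [← neg_eq_iff_eq_neg, neg_rayOfNeZero] at h
  exact h

/-- Near a point a continuous field of positive vectors spans the kernel, and `l` evaluated on it is
continuous. At the point itself the sign does not depend on the positive vector chosen. -/
lemma isOpen_setOf_isPositive (o : KerOrientation Ω) (hl : l.IsSmooth) :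
    IsOpen {x | ∃ v : TangentSpace (𝓡 d) x, o.IsPositive v ∧ 0 < l x ![v]} := by
  refine isOpen_iff_mem_nhds.2 fun x₀ ⟨v, hv, hlv⟩ ↦ ?_
  obtain ⟨U, hU, X, hXc, hX⟩ := o.locally_spanned x₀
  have hX' : ∀ x ∈ U, o.IsPositive (X x) := fun x hx ↦ by
    obtain ⟨h1, h2, h3⟩ := hX x hx
    exact ⟨h1, h2, h3.symm⟩
  have hX₀ : 0 < l x₀ ![X x₀] := by
    obtain ⟨c, hc, h⟩ := hv.exists_smul_eq (hX' x₀ (mem_of_mem_nhds hU))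
    rw [h, oneForm_smul]
    positivity
  have hs : (chartAt (EuclideanSpace ℝ (Fin d)) x₀).source ∈ 𝓝 x₀ :=
    (chartAt (EuclideanSpace ℝ (Fin d)) x₀).open_source.mem_nhds (mem_chart_source _ _)
  have hc : ContinuousAt (fun x ↦ l x ![X x]) x₀ := by
    have h1 := (FiberBundle.continuousAt_totalSpace (EuclideanSpace ℝ (Fin d)) _).1
      (hXc.continuousAt hU)
    have h2 : ContinuousAt (fun x ↦ toCovector _ (l.inChart x₀ (extChartAt (𝓡 d) x₀ x))) x₀ :=
      (toCovector _).continuous.continuousAt.comp (ContinuousAt.comp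
        (hl.contDiffAt (mem_extChartAt_target x₀)).continuousAt (continuousAt_extChartAt x₀))
    refine (h2.clm_apply h1.2).congr ?_
    filter_upwards [hs] with x hx
    refine (toCovector_apply _ _).trans (Eq.trans ?_ (DForm.apply_eq_inChart l hx ![X x]).symm)
    refine congrArg _ ?_
    rw [trivializationAt_tangent_snd_eq_mfderiv hx]
    ext i; fin_cases i; rfl
  filter_upwards [hU, hc.eventually (lt_mem_nhds hX₀)] with x hx hlx
  exact ⟨X x, hX' x hx, hlx⟩

/-- A one-form without zeros on `ker Ω ∖ 0` has constant sign on positive vectors. -/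
lemma constant_sign [PreconnectedSpace M] (o : KerOrientation Ω) (hl : l.IsSmooth)
    (h0 : ∀ x, ∀ v : TangentSpace (𝓡 d) x, v ≠ 0 → v ∈ Ω.ker x → l x ![v] ≠ 0) :
    (∀ x, ∀ v : TangentSpace (𝓡 d) x, o.IsPositive v → 0 < l x ![v]) ∨
      ∀ x, ∀ v : TangentSpace (𝓡 d) x, o.IsPositive v → l x ![v] < 0 := by
  have h1 := o.isOpen_setOf_isPositive hl
  -- Applied to `-l`, this opens the set of negative sign, which is the complement of the first set
  -- because `l` has no zeros on the kernel; connectedness concludes.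
  have h2 := o.isOpen_setOf_isPositive (hl.const_smul (-1))
  have hneg : ∀ x, ∀ v : TangentSpace (𝓡 d) x, ((-1 : ℝ) • l) x ![v] = -l x ![v] := fun x v ↦
    neg_one_mul _
  simp only [hneg, neg_pos] at h2
  have hsign : ∀ {x} {v w : TangentSpace (𝓡 d) x}, o.IsPositive v → o.IsPositive w →
      0 < l x ![v] → 0 < l x ![w] := fun hv hw h ↦ by
    obtain ⟨c, hc, rfl⟩ := hv.exists_smul_eq hw
    rw [oneForm_smul]
    positivity
  have hcompl : {x | ∃ v : TangentSpace (𝓡 d) x, o.IsPositive v ∧ 0 < l x ![v]}ᶜ =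
      {x | ∃ v : TangentSpace (𝓡 d) x, o.IsPositive v ∧ l x ![v] < 0} := by
    ext x
    constructor
    · intro h
      obtain ⟨v, hv⟩ := o.exists_isPositive x
      exact ⟨v, hv, lt_of_le_of_ne (not_lt.1 fun h' ↦ h ⟨v, hv, h'⟩)
        (h0 x v hv.ne_zero hv.mem_ker)⟩
    · rintro ⟨v, hv, h⟩ ⟨w, hw, h'⟩
      exact lt_asymm h (hsign hw hv h')
  rcases isClopen_iff.1 ⟨⟨hcompl ▸ h2⟩, h1⟩ with h | h
  · refine Or.inr fun x v hv ↦ ?_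
    have hx : x ∈ {x | ∃ v : TangentSpace (𝓡 d) x, o.IsPositive v ∧ 0 < l x ![v]}ᶜ := by
      rw [h]; simp
    exact lt_of_le_of_ne (not_lt.1 fun h' ↦ hx ⟨v, hv, h'⟩) (h0 x v hv.ne_zero hv.mem_ker)
  · refine Or.inl fun x v hv ↦ ?_
    obtain ⟨w, hw, h'⟩ : x ∈ {x | ∃ v : TangentSpace (𝓡 d) x, o.IsPositive v ∧ 0 < l x ![v]} := by
      rw [h]; trivial
    exact hsign hw hv h'

end KerOrientation

variable [IsManifold (𝓡 d) ∞ M] {n : ℕ}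

/-- On `ker Ω`, the forms `l` and `ρ^* l` have opposite signs. -/
lemma mul_pullback_neg [PreconnectedSpace M] (hd : d = 1 + 2 * (n - 1))
    (hΩ : ∀ x, Module.finrank ℝ (Ω.ker x) = 1) (hρ : IsRealStructure Ω ρ)
    (hl : IsContactForm n Ω l) {x : M} {v : TangentSpace (𝓡 d) x} (hv : v ≠ 0)
    (hk : v ∈ Ω.ker x) : l x ![v] * DForm.pullback ρ l x ![v] < 0 := by
  obtain ⟨o, ho⟩ := hρ.reverses
  obtain ⟨w, hw⟩ := o.exists_isPositive x
  -- Since `-dρ(w)` is positive at `ρ x`, the number `-(ρ^* l)(w)` has the same sign as `l(w)`.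
  have hw' := KerOrientation.isPositive_neg_of_reversed ho hw
  have hneg : l (ρ x) ![-(mfderiv (𝓡 d) (𝓡 d) ρ x w)] = -DForm.pullback ρ l x ![w] := by
    rw [DForm.pullback, compCLM_one, ← neg_one_smul ℝ, oneForm_smul, neg_one_mul]
  have key : l x ![w] * DForm.pullback ρ l x ![w] < 0 := by
    rcases o.constant_sign hl.smooth (fun x v ↦ hl.apply_ne_zero hd) with h | h
    · have h1 := h x w hw
      have h2 := h _ _ hw'
      rw [hneg] at h2
      nlinarith
    · have h1 := h x w hw
      have h2 := h _ _ hw'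
      rw [hneg] at h2
      nlinarith
  -- Any kernel vector is `c • w`, and the product of the two values scales by `c ^ 2`.
  obtain ⟨c, hc⟩ := (finrank_eq_one_iff_of_nonzero' _ hw.2.1).1 (hΩ x) ⟨v, hk⟩
  have hc' : v = c • w := congrArg Subtype.val hc.symm
  have hc0 : c ≠ 0 := by
    rintro rfl
    exact hv (hc'.trans (zero_smul _ _))
  rw [hc', oneForm_smul, oneForm_smul]
  have : 0 < c ^ 2 := by positivity
  nlinarith

/-- For `a` and `b` of opposite signs, `(1 - t) a` and `-t b` never cancel and are not both zero.
Multiplying by `a` removes the case distinction on signs. -/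
lemma linearPath_apply_ne_zero [PreconnectedSpace M] (hd : d = 1 + 2 * (n - 1))
    (hΩ : ∀ x, Module.finrank ℝ (Ω.ker x) = 1) (hρ : IsRealStructure Ω ρ)
    (hl : IsContactForm n Ω l) {t : ℝ} (ht : t ∈ Icc (0 : ℝ) 1) {x : M}
    {v : TangentSpace (𝓡 d) x} (hv : v ≠ 0) (hk : v ∈ Ω.ker x) :
    linearPath ρ l t x ![v] ≠ 0 := by
  have h := mul_pullback_neg hd hΩ hρ hl hv hk
  rw [linearPath_apply]
  generalize l x ![v] = a at *
  generalize DForm.pullback ρ l x ![v] = b at *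
  intro h0
  have h1 : a ≠ 0 := by rintro rfl; simp at h
  have h2 : 0 < a ^ 2 := by positivity
  have h3 : (1 - t) * a ^ 2 = t * (a * b) := by linear_combination a * h0
  rcases ht.1.eq_or_lt with rfl | ht0
  · nlinarith
  · nlinarith [ht.2, mul_pos ht0 (neg_pos.2 h), mul_nonneg (sub_nonneg.2 ht.2) h2.le]

lemma isSmooth_linearPath (hρ : ContMDiff (𝓡 d) (𝓡 d) ∞ ρ) (hl : l.IsSmooth) (t : ℝ) :
    (linearPath ρ l t).IsSmooth := by
  rw [linearPath_eq_add]
  exact (hl.const_smul _).add ((DForm.IsSmooth.pullback hρ hl).const_smul _)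

/-- Because `d(ρ^* l) = ρ^* Ω = -Ω`, the coefficients of `Ω` add up to `(1 - t) + t = 1`. -/
lemma extd_linearPath (hρ : IsRealStructure Ω ρ) (hl : IsContactForm n Ω l) (t : ℝ) :
    (linearPath ρ l t).extd = Ω := by
  have h := DForm.IsSmooth.pullback hρ.smooth hl.smooth
  rw [linearPath_eq_add, DForm.extd_add (hl.smooth.const_smul _) (h.const_smul _),
    DForm.extd_smul, DForm.extd_smul, DForm.extd_pullback hρ.smooth hl.smooth, hl.extd_eq,
    hρ.pullback_eq, smul_neg, neg_smul, neg_neg, ← add_smul, sub_add_cancel, one_smul]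

lemma isContactForm_linearPath [PreconnectedSpace M] (hd : d = 1 + 2 * (n - 1))
    (hΩ : ∀ x, Module.finrank ℝ (Ω.ker x) = 1) (hρ : IsRealStructure Ω ρ)
    (hl : IsContactForm n Ω l) {t : ℝ} (ht : t ∈ Icc (0 : ℝ) 1) :
    IsContactForm n Ω (linearPath ρ l t) where
  smooth := isSmooth_linearPath hρ.smooth hl.smooth t
  extd_eq := extd_linearPath hρ hl t
  wedge_ne_zero x := by
    obtain ⟨v, hv, hk⟩ := exists_ne_zero_mem_ker hΩ x
    exact wedge_wedgePow_ne_zero ((finrank_tangentSpace x).trans hd) hv (DForm.mem_ker_two.1 hk)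
      (hl.wedge_ne_zero x) (linearPath_apply_ne_zero hd hΩ hρ hl ht hv hk)

end RealHamiltonian

/-! ### The Moser and Reeb fields and their regularity -/

section MoserField

variable {d : ℕ} {M : Type*} [TopologicalSpace M] [ChartedSpace (EuclideanSpace ℝ (Fin d)) M]

/-- The path of one-forms `l - t β`. -/
def affinePath (l β : DForm d M 1) (t : ℝ) : DForm d M 1 := l + (-t) • β

/-- The vector field solving the Moser equation for the path `l - t β`. -/
def moserField (l β : DForm d M 1) (Ω : DForm d M 2) (t : ℝ) (x : M) : TangentSpace (𝓡 d) x :=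
  moserVector (E := EuclideanSpace ℝ (Fin d)) (affinePath l β t x) (Ω x) (β x)

/-- The Reeb vector field of the form `l - t β`. -/
def reebField (l β : DForm d M 1) (Ω : DForm d M 2) (t : ℝ) (x : M) : TangentSpace (𝓡 d) x :=
  reebVector (E := EuclideanSpace ℝ (Fin d)) (affinePath l β t x) (Ω x)

variable {l β : DForm d M 1} {Ω : DForm d M 2}

lemma isMoserPair_moserField {t : ℝ} {x : M} (h : Nondegenerate (affinePath l β t x) (Ω x))
    (hk : ∃ v : TangentSpace (𝓡 d) x, v ≠ 0 ∧ v ∈ Ω.ker x) :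
    IsMoserPair (affinePath l β t x) (Ω x) (β x) (moserField l β Ω t x) (reebField l β Ω t x) := by
  obtain ⟨v, hv, hk⟩ := hk
  exact isMoserPair_moserVector (E := EuclideanSpace ℝ (Fin d)) (β x) h hv (DForm.mem_ker_two.1 hk)

lemma contDiffAt_inChart_affinePath (hl : l.IsSmooth) (hβ : β.IsSmooth) {x₀ : M}
    {q : ℝ × EuclideanSpace ℝ (Fin d)} (hq : q.2 ∈ (extChartAt (𝓡 d) x₀).target) :
    ContDiffAt ℝ ∞ (fun q : ℝ × EuclideanSpace ℝ (Fin d) ↦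
      (affinePath l β q.1).inChart x₀ q.2) q := by
  have h1 : ContDiffAt ℝ ∞ (fun q : ℝ × EuclideanSpace ℝ (Fin d) ↦ l.inChart x₀ q.2) q :=
    (hl.contDiffAt hq).comp q contDiffAt_snd
  have h2 : ContDiffAt ℝ ∞ (fun q : ℝ × EuclideanSpace ℝ (Fin d) ↦ β.inChart x₀ q.2) q :=
    (hβ.contDiffAt hq).comp q contDiffAt_snd
  exact h1.add (contDiffAt_fst.neg.smul h2)

lemma contDiffAt_inChart_snd {k : ℕ} {α : DForm d M k} (hα : α.IsSmooth) {x₀ : M}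
    {q : ℝ × EuclideanSpace ℝ (Fin d)} (hq : q.2 ∈ (extChartAt (𝓡 d) x₀).target) :
    ContDiffAt ℝ ∞ (fun q : ℝ × EuclideanSpace ℝ (Fin d) ↦ α.inChart x₀ q.2) q :=
  (hα.contDiffAt hq).comp q contDiffAt_snd

variable [IsManifold (𝓡 d) ∞ M]

lemma bijective_mfderiv_extChartAt {x₀ x : M}
    (hx : x ∈ (chartAt (EuclideanSpace ℝ (Fin d)) x₀).source) :
    Function.Bijective (mfderiv (𝓡 d) 𝓘(ℝ, EuclideanSpace ℝ (Fin d)) (extChartAt (𝓡 d) x₀) x) :=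
  (isInvertible_mfderiv_extChartAt (by rwa [extChartAt_source])).bijective

lemma nondegenerate_inChart_iff {a : DForm d M 1} {x₀ x : M}
    (hx : x ∈ (chartAt (EuclideanSpace ℝ (Fin d)) x₀).source) :
    Nondegenerate (a.inChart x₀ (extChartAt (𝓡 d) x₀ x)) (Ω.inChart x₀ (extChartAt (𝓡 d) x₀ x)) ↔
      Nondegenerate (a x) (Ω x) := by
  have h := nondegenerate_comp_iff (a := a.inChart x₀ (extChartAt (𝓡 d) x₀ x))
    (w := Ω.inChart x₀ (extChartAt (𝓡 d) x₀ x)) (bijective_mfderiv_extChartAt hx)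
  rw [DForm.compCLM_mfderiv_extChartAt a hx, DForm.compCLM_mfderiv_extChartAt Ω hx] at h
  exact h.symm

lemma exists_ker_inChart {x₀ x : M} (hx : x ∈ (chartAt (EuclideanSpace ℝ (Fin d)) x₀).source)
    (hk : ∃ v : TangentSpace (𝓡 d) x, v ≠ 0 ∧ v ∈ Ω.ker x) :
    ∃ R ≠ 0, ∀ u, Ω.inChart x₀ (extChartAt (𝓡 d) x₀ x) ![R, u] = 0 := by
  obtain ⟨v, hv, hk⟩ := hk
  have hb := bijective_mfderiv_extChartAt hx
  refine ⟨mfderiv (𝓡 d) 𝓘(ℝ, EuclideanSpace ℝ (Fin d)) (extChartAt (𝓡 d) x₀) x v,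
    fun h ↦ hv (hb.1 (h.trans (map_zero _).symm)), fun u ↦ ?_⟩
  obtain ⟨u, rfl⟩ := hb.2 u
  refine (compCLM_two _ _ v u).symm.trans ?_
  rw [DForm.compCLM_mfderiv_extChartAt Ω hx]
  exact DForm.mem_ker_two.1 hk u

lemma isMoserPair_inChart {t : ℝ} {x₀ x : M}
    (hx : x ∈ (chartAt (EuclideanSpace ℝ (Fin d)) x₀).source)
    (h : Nondegenerate (affinePath l β t x) (Ω x))
    (hk : ∃ v : TangentSpace (𝓡 d) x, v ≠ 0 ∧ v ∈ Ω.ker x) :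
    IsMoserPair ((affinePath l β t).inChart x₀ (extChartAt (𝓡 d) x₀ x))
      (Ω.inChart x₀ (extChartAt (𝓡 d) x₀ x)) (β.inChart x₀ (extChartAt (𝓡 d) x₀ x))
      (moserVector ((affinePath l β t).inChart x₀ (extChartAt (𝓡 d) x₀ x))
        (Ω.inChart x₀ (extChartAt (𝓡 d) x₀ x)) (β.inChart x₀ (extChartAt (𝓡 d) x₀ x)))
      (reebVector ((affinePath l β t).inChart x₀ (extChartAt (𝓡 d) x₀ x))
        (Ω.inChart x₀ (extChartAt (𝓡 d) x₀ x))) := by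
  obtain ⟨R, hR, hRΩ⟩ := exists_ker_inChart hx hk
  exact isMoserPair_moserVector _ ((nondegenerate_inChart_iff hx).2 h) hR hRΩ

/-- Both sides solve the same nondegenerate pointwise problem, hence agree. The fields are defined
fibre by fibre, and this is what makes their regularity visible in a fixed chart. -/
lemma mfderiv_extChartAt_moserField {t : ℝ} {x₀ x : M}
    (hx : x ∈ (chartAt (EuclideanSpace ℝ (Fin d)) x₀).source)
    (h : Nondegenerate (affinePath l β t x) (Ω x))
    (hk : ∃ v : TangentSpace (𝓡 d) x, v ≠ 0 ∧ v ∈ Ω.ker x) :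
    mfderiv (𝓡 d) 𝓘(ℝ, EuclideanSpace ℝ (Fin d)) (extChartAt (𝓡 d) x₀) x (moserField l β Ω t x) =
        moserVector ((affinePath l β t).inChart x₀ (extChartAt (𝓡 d) x₀ x))
          (Ω.inChart x₀ (extChartAt (𝓡 d) x₀ x)) (β.inChart x₀ (extChartAt (𝓡 d) x₀ x)) ∧
      mfderiv (𝓡 d) 𝓘(ℝ, EuclideanSpace ℝ (Fin d)) (extChartAt (𝓡 d) x₀) x (reebField l β Ω t x) =
        reebVector ((affinePath l β t).inChart x₀ (extChartAt (𝓡 d) x₀ x))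
          (Ω.inChart x₀ (extChartAt (𝓡 d) x₀ x)) := by
  have h1 := isMoserPair_moserField h hk
  rw [← DForm.compCLM_mfderiv_extChartAt (affinePath l β t) hx,
    ← DForm.compCLM_mfderiv_extChartAt Ω hx, ← DForm.compCLM_mfderiv_extChartAt β hx] at h1
  exact (h1.map (bijective_mfderiv_extChartAt hx).2).unique (isMoserPair_inChart hx h hk)
    ((nondegenerate_inChart_iff hx).2 h)

lemma isInvertible_moserOperator_inChart {t : ℝ} {x₀ x : M}
    (hx : x ∈ (chartAt (EuclideanSpace ℝ (Fin d)) x₀).source)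
    (h : Nondegenerate (affinePath l β t x) (Ω x))
    (hk : ∃ v : TangentSpace (𝓡 d) x, v ≠ 0 ∧ v ∈ Ω.ker x) :
    (moserOperator ((affinePath l β t).inChart x₀ (extChartAt (𝓡 d) x₀ x))
      (Ω.inChart x₀ (extChartAt (𝓡 d) x₀ x))).IsInvertible := by
  obtain ⟨R, hR, hRΩ⟩ := exists_ker_inChart hx hk
  exact isInvertible_moserOperator ((nondegenerate_inChart_iff hx).2 h) hR hRΩ

omit [IsManifold (𝓡 d) ∞ M] in
lemma contMDiffAt_extChartAt_snd {p : ℝ × M} :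
    ContMDiffAt (𝓘(ℝ, ℝ).prod (𝓡 d)) 𝓘(ℝ, ℝ × EuclideanSpace ℝ (Fin d)) ∞
      (fun q : ℝ × M ↦ (q.1, extChartAt (𝓡 d) p.2 q.2)) p :=
  contMDiffAt_fst.prodMk_space (contMDiffAt_extChartAt.comp p contMDiffAt_snd)

lemma isOpen_setOf_nondegenerate (hl : l.IsSmooth) (hβ : β.IsSmooth) (hΩ : Ω.IsSmooth)
    (hk : ∀ x, ∃ v : TangentSpace (𝓡 d) x, v ≠ 0 ∧ v ∈ Ω.ker x) :
    IsOpen {p : ℝ × M | Nondegenerate (affinePath l β p.1 p.2) (Ω p.2)} := by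
  refine isOpen_iff_mem_nhds.2 fun p hp ↦ ?_
  have hs := mem_chart_source (EuclideanSpace ℝ (Fin d)) p.2
  obtain ⟨e, he⟩ := isInvertible_moserOperator_inChart hs hp (hk p.2)
  have hc : ContinuousAt (fun q : ℝ × M ↦
      moserOperator ((affinePath l β q.1).inChart p.2 (extChartAt (𝓡 d) p.2 q.2))
        (Ω.inChart p.2 (extChartAt (𝓡 d) p.2 q.2))) p :=
    ContinuousAt.comp (f := fun q : ℝ × M ↦ (q.1, extChartAt (𝓡 d) p.2 q.2))
      (g := fun q ↦ moserOperator ((affinePath l β q.1).inChart p.2 q.2) (Ω.inChart p.2 q.2))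
      (contDiffAt_moserOperator
        (contDiffAt_inChart_affinePath hl hβ (mem_extChartAt_target p.2))
        (contDiffAt_inChart_snd hΩ (mem_extChartAt_target p.2))).continuousAt
      contMDiffAt_extChartAt_snd.continuousAt
  have hn := e.nhds
  rw [he] at hn
  filter_upwards [hc.preimage_mem_nhds hn, continuousAt_snd.preimage_mem_nhds
    ((chartAt (EuclideanSpace ℝ (Fin d)) p.2).open_source.mem_nhds hs)] with q ⟨e', he'⟩ hq
  exact (nondegenerate_inChart_iff hq).1 (nondegenerate_of_isInvertible ⟨e', he'⟩)

lemma contMDiffAt_moserField (hl : l.IsSmooth) (hβ : β.IsSmooth) (hΩ : Ω.IsSmooth)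
    (hk : ∀ x, ∃ v : TangentSpace (𝓡 d) x, v ≠ 0 ∧ v ∈ Ω.ker x) {p : ℝ × M}
    (hp : Nondegenerate (affinePath l β p.1 p.2) (Ω p.2)) :
    ContMDiffAt (𝓘(ℝ, ℝ).prod (𝓡 d)) (𝓡 d).tangent ∞
      (fun p : ℝ × M ↦ (⟨p.2, moserField l β Ω p.1 p.2⟩ : TangentBundle (𝓡 d) M)) p := by
  rw [contMDiffAt_tangentBundle_iff]
  refine ⟨contMDiffAt_snd, ?_⟩
  have hs := mem_chart_source (EuclideanSpace ℝ (Fin d)) p.2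
  have ht := mem_extChartAt_target (I := 𝓡 d) p.2
  have h1 : ContDiffAt ℝ ∞ (fun q : ℝ × EuclideanSpace ℝ (Fin d) ↦
      moserVector ((affinePath l β q.1).inChart p.2 q.2) (Ω.inChart p.2 q.2) (β.inChart p.2 q.2))
      (p.1, extChartAt (𝓡 d) p.2 p.2) :=
    contDiffAt_moserVector (contDiffAt_inChart_affinePath hl hβ ht) (contDiffAt_inChart_snd hΩ ht)
      (contDiffAt_inChart_snd hβ ht) (isInvertible_moserOperator_inChart hs hp (hk p.2))
  refine (h1.contMDiffAt.comp p contMDiffAt_extChartAt_snd).congr_of_eventuallyEq ?_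
  filter_upwards [(isOpen_setOf_nondegenerate hl hβ hΩ hk).mem_nhds hp,
    continuousAt_snd.preimage_mem_nhds
      ((chartAt (EuclideanSpace ℝ (Fin d)) p.2).open_source.mem_nhds hs)] with q hq1 hq2
  exact (mfderiv_extChartAt_moserField hq2 hq1 (hk q.2)).1

/-- This function is the coefficient of the scalar equation along the flow, for which continuity is
enough. -/
lemma continuousAt_apply_reebField (hl : l.IsSmooth) (hβ : β.IsSmooth) (hΩ : Ω.IsSmooth)
    (hk : ∀ x, ∃ v : TangentSpace (𝓡 d) x, v ≠ 0 ∧ v ∈ Ω.ker x) {p : ℝ × M}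
    (hp : Nondegenerate (affinePath l β p.1 p.2) (Ω p.2)) :
    ContinuousAt (fun p : ℝ × M ↦ β p.2 ![reebField l β Ω p.1 p.2]) p := by
  have hs := mem_chart_source (EuclideanSpace ℝ (Fin d)) p.2
  have ht := mem_extChartAt_target (I := 𝓡 d) p.2
  have h1 : ContDiffAt ℝ ∞ (fun q : ℝ × EuclideanSpace ℝ (Fin d) ↦
      toCovector _ (β.inChart p.2 q.2)
        (reebVector ((affinePath l β q.1).inChart p.2 q.2) (Ω.inChart p.2 q.2)))
      (p.1, extChartAt (𝓡 d) p.2 p.2) :=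
    (contDiffAt_toCovector (contDiffAt_inChart_snd hβ ht)).clm_apply
      (contDiffAt_reebVector (contDiffAt_inChart_affinePath hl hβ ht)
        (contDiffAt_inChart_snd hΩ ht) (isInvertible_moserOperator_inChart hs hp (hk p.2)))
  refine (ContinuousAt.comp (f := fun q : ℝ × M ↦ (q.1, extChartAt (𝓡 d) p.2 q.2))
    h1.continuousAt contMDiffAt_extChartAt_snd.continuousAt).congr ?_
  filter_upwards [(isOpen_setOf_nondegenerate hl hβ hΩ hk).mem_nhds hp,
    continuousAt_snd.preimage_mem_nhds
      ((chartAt (EuclideanSpace ℝ (Fin d)) p.2).open_source.mem_nhds hs)] with q hq1 hq2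
  refine (toCovector_apply _ _).trans (Eq.trans ?_ (DForm.apply_eq_inChart β hq2 _).symm)
  refine congrArg _ (funext fun i ↦ ?_)
  fin_cases i
  exact (mfderiv_extChartAt_moserField hq2 hq1 (hk q.2)).2.symm

end MoserField

/-! ### Moser's derivative formula in coordinates and the scalar equation -/

section MoserDerivative

variable {E F : Type*} [NormedAddCommGroup E] [NormedSpace ℝ E]
  [NormedAddCommGroup F] [NormedSpace ℝ F]

lemma hasDerivAt_fderiv_fst {f : ℝ × F → E} {t₀ : ℝ} {u₀ : F}
    (hf : DifferentiableAt ℝ (fderiv ℝ f) (t₀, u₀)) (w : ℝ × F) :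
    HasDerivAt (fun t ↦ fderiv ℝ f (t, u₀) w)
      (fderiv ℝ (fderiv ℝ f) (t₀, u₀) (1, 0) w) t₀ := by
  have ht : HasDerivAt (fun t ↦ (t, u₀)) ((1 : ℝ), (0 : F)) t₀ :=
    (hasDerivAt_id t₀).prodMk (hasDerivAt_const t₀ u₀)
  have h1 : HasDerivAt (fun t ↦ fderiv ℝ f (t, u₀))
    (fderiv ℝ (fderiv ℝ f) (t₀, u₀) (1, 0)) t₀ := hf.hasFDerivAt.comp_hasDerivAt t₀ ht
  have h2 : HasFDerivAt (fun L : ℝ × F →L[ℝ] E ↦ L w) (ContinuousLinearMap.apply ℝ E w)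
    (fderiv ℝ f (t₀, u₀)) := (ContinuousLinearMap.apply ℝ E w).hasFDerivAt
  exact h2.comp_hasDerivAt t₀ h1

lemma hasFDerivAt_fderiv_snd {f : ℝ × F → E} {t₀ : ℝ} {u₀ : F}
    (hf : DifferentiableAt ℝ (fderiv ℝ f) (t₀, u₀)) (w : ℝ × F) :
    HasFDerivAt (fun u ↦ fderiv ℝ f (t₀, u) w) ((ContinuousLinearMap.apply ℝ E w).comp
      ((fderiv ℝ (fderiv ℝ f) (t₀, u₀)).comp (ContinuousLinearMap.inr ℝ ℝ F))) u₀ := by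
  have h2 : HasFDerivAt (fun L : ℝ × F →L[ℝ] E ↦ L w) (ContinuousLinearMap.apply ℝ E w)
    (fderiv ℝ f (t₀, u₀)) := (ContinuousLinearMap.apply ℝ E w).hasFDerivAt
  exact h2.comp u₀ (hf.hasFDerivAt.comp u₀ (hasFDerivAt_prodMk_right t₀ u₀))

/-- Moser's derivative formula for the pullback of the path of covector fields `a - t b` under a
map whose time derivative is given by the vector field `X`. -/
lemma hasDerivAt_apply_fderiv {f : ℝ × F → E} {t₀ : ℝ} {u₀ : F} (hf : ContDiffAt ℝ 2 f (t₀, u₀))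
    {a b : E → E →L[ℝ] ℝ} {X : E → E} {y₀ : E} (hy₀ : f (t₀, u₀) = y₀)
    (ha : DifferentiableAt ℝ a y₀) (hb : DifferentiableAt ℝ b y₀) (hX : DifferentiableAt ℝ X y₀)
    (hfX : ∀ᶠ u in 𝓝 u₀, fderiv ℝ f (t₀, u) (1, 0) = X (f (t₀, u)))
    (hA : ∀ᶠ y in 𝓝 y₀, (a y - t₀ • b y) (X y) = 0) {r : ℝ}
    (hd : ∀ q, fderiv ℝ (fun y ↦ a y - t₀ • b y) y₀ (X y₀) q -
      fderiv ℝ (fun y ↦ a y - t₀ • b y) y₀ q (X y₀) = b y₀ q - r * (a y₀ - t₀ • b y₀) q) (w : F) :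
    HasDerivAt (fun t ↦ (a (f (t, u₀)) - t • b (f (t, u₀))) (fderiv ℝ f (t, u₀) (0, w)))
      (-r * (a y₀ - t₀ • b y₀) (fderiv ℝ f (t₀, u₀) (0, w))) t₀ := by
  have hf1 : DifferentiableAt ℝ f (t₀, u₀) := hf.differentiableAt (by simp)
  have hf2 : DifferentiableAt ℝ (fderiv ℝ f) (t₀, u₀) :=
    (hf.fderiv_right (m := 1) (by norm_num)).differentiableAt (by simp)
  set q := fderiv ℝ f (t₀, u₀) (0, w) with hq
  have ht : HasDerivAt (fun t ↦ (t, u₀)) ((1 : ℝ), (0 : F)) t₀ :=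
    (hasDerivAt_id t₀).prodMk (hasDerivAt_const t₀ u₀)
  have hu : HasFDerivAt (fun u ↦ (t₀, u)) (ContinuousLinearMap.inr ℝ ℝ F) u₀ :=
    hasFDerivAt_prodMk_right t₀ u₀
  have hX₀ : fderiv ℝ f (t₀, u₀) (1, 0) = X y₀ := by rw [hfX.self_of_nhds, hy₀]
  have hft : HasDerivAt (fun t ↦ f (t, u₀)) (X y₀) t₀ := by
    rw [← hX₀]
    exact hf1.hasFDerivAt.comp_hasDerivAt t₀ ht
  have hfu : HasFDerivAt (fun u ↦ f (t₀, u)) ((fderiv ℝ f (t₀, u₀)).comp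
      (ContinuousLinearMap.inr ℝ ℝ F)) u₀ := hf1.hasFDerivAt.comp u₀ hu
  -- Symmetry of second derivatives: the `t`-derivative of `∂_w f` is the `w`-derivative of `∂_t f =
  -- X ∘ f`.
  have hG : HasDerivAt (fun t ↦ fderiv ℝ f (t, u₀) (0, w)) (fderiv ℝ X y₀ q) t₀ := by
    have h2 : HasFDerivAt (fun u ↦ fderiv ℝ f (t₀, u) (1, 0))
        (((fderiv ℝ X y₀).comp ((fderiv ℝ f (t₀, u₀)).comp (ContinuousLinearMap.inr ℝ ℝ F)))) u₀ := by
      refine HasFDerivAt.congr_of_eventuallyEq ?_ hfX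
      refine HasFDerivAt.comp (g := X) u₀ ?_ hfu
      rw [hy₀]; exact hX.hasFDerivAt
    have h4 : fderiv ℝ X y₀ q = fderiv ℝ (fderiv ℝ f) (t₀, u₀) (0, w) (1, 0) :=
      congrArg (fun L : F →L[ℝ] E ↦ L w) (h2.unique (hasFDerivAt_fderiv_snd hf2 (1, 0)))
    rw [h4, ← hf.isSymmSndFDerivAt (by simp) (1, 0) (0, w)]
    exact hasDerivAt_fderiv_fst hf2 (0, w)
  have hta : HasDerivAt (fun t ↦ a (f (t, u₀))) (fderiv ℝ a y₀ (X y₀)) t₀ := by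
    refine HasFDerivAt.comp_hasDerivAt (l := a) t₀ ?_ hft
    rw [hy₀]; exact ha.hasFDerivAt
  have htb : HasDerivAt (fun t ↦ b (f (t, u₀))) (fderiv ℝ b y₀ (X y₀)) t₀ := by
    refine HasFDerivAt.comp_hasDerivAt (l := b) t₀ ?_ hft
    rw [hy₀]; exact hb.hasFDerivAt
  have hdA : HasFDerivAt (fun y ↦ a y - t₀ • b y) (fderiv ℝ a y₀ - t₀ • fderiv ℝ b y₀) y₀ :=
    ha.hasFDerivAt.sub (hb.hasFDerivAt.const_smul t₀)
  -- This differentiates the identity `A(X) = 0`, with `A = a - t₀ b`, in the direction `q`.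
  have hAX : fderiv ℝ (fun y ↦ a y - t₀ • b y) y₀ q (X y₀) +
      (a y₀ - t₀ • b y₀) (fderiv ℝ X y₀ q) = 0 := by
    have h1 := hdA.clm_apply hX.hasFDerivAt
    have h2 : HasFDerivAt (fun y ↦ (a y - t₀ • b y) (X y)) (0 : E →L[ℝ] ℝ) y₀ :=
      (hasFDerivAt_const (0 : ℝ) y₀).congr_of_eventuallyEq hA
    have h3 := congrArg (fun L : E →L[ℝ] ℝ ↦ L q) (h1.unique h2)
    rw [hdA.fderiv]
    simpa [add_comm] using h3
  have hmain := (hta.sub ((hasDerivAt_id t₀).smul htb)).clm_apply hG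
  refine hmain.congr_deriv ?_
  have hdq := hd q
  rw [hdA.fderiv] at hdq hAX
  simp only [id, hy₀, ← hq, one_smul, sub_apply, smul_apply, add_apply, smul_eq_mul, Pi.sub_apply,
    Pi.smul_apply'] at hdq hAX ⊢
  -- Cartan's formula in coordinates: `hAX` replaces `A(DX q)` by `-(DA q) X`, so the derivative is
  -- `dA(X, q) - b(q) = -r A(q)`.
  linear_combination hdq + hAX

/-- A solution of a linear scalar equation which vanishes at time `0` if and only if it vanishes
at time `t`. -/
lemma eq_zero_iff_of_hasDerivAt_mul {g r : ℝ → ℝ} {t : ℝ} (ht : 0 ≤ t)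
    (hr : ContinuousOn r (Icc 0 t)) (hg : ∀ s ∈ Icc 0 t, HasDerivAt g (-r s * g s) s) :
    g 0 = 0 ↔ g t = 0 := by
  obtain ⟨K, hK⟩ := isCompact_Icc.exists_bound_of_continuousOn hr
  have hgc : ContinuousOn g (Icc 0 t) := fun s hs ↦ (hg s hs).continuousAt.continuousWithinAt
  constructor
  · intro h0
    refine eq_zero_of_abs_deriv_le_mul_abs_self_of_eq_zero_right (K := K) hgc
      (fun s hs ↦ (hg s ⟨hs.1, hs.2.le⟩).hasDerivWithinAt) h0 (fun s hs ↦ ?_) t ⟨ht, le_rfl⟩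
    rw [norm_mul, norm_neg]
    exact mul_le_mul_of_nonneg_right (hK s ⟨hs.1, hs.2.le⟩) (norm_nonneg _)
  · intro h0
    -- The converse is the forward uniqueness statement for the time-reversed function `s ↦ g (t -
    -- s)`.
    have hmem : ∀ s ∈ Icc 0 t, t - s ∈ Icc 0 t := fun s hs ↦
      ⟨by linarith [hs.2], by linarith [hs.1]⟩
    have h := eq_zero_of_abs_deriv_le_mul_abs_self_of_eq_zero_right (K := K) (a := 0) (b := t)
      (f := fun s ↦ g (t - s)) (f' := fun s ↦ r (t - s) * g (t - s))
      (hgc.comp (by fun_prop) hmem) (fun s hs ↦ ?_) (by simpa using h0) (fun s hs ↦ ?_) t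
      ⟨ht, le_rfl⟩
    · simpa using h
    · have h1 := (hg (t - s) (hmem s ⟨hs.1, hs.2.le⟩)).scomp s ((hasDerivAt_id s).const_sub t)
      refine (h1.congr_deriv ?_).hasDerivWithinAt
      simp
    · rw [norm_mul]
      exact mul_le_mul_of_nonneg_right (hK _ (hmem s ⟨hs.1, hs.2.le⟩)) (norm_nonneg _)

end MoserDerivative

/-! ### The derivative of the pulled-back path on the manifold -/

section Gray

lemma extDeriv_oneForm_apply {E : Type*} [NormedAddCommGroup E] [NormedSpace ℝ E]
    {α : E → E [⋀^Fin 1]→L[ℝ] ℝ} {y : E} (h : DifferentiableAt ℝ α y) (u v : E) :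
    extDeriv α y ![u, v] =
      fderiv ℝ (fun z ↦ toCovector E (α z)) y u v - fderiv ℝ (fun z ↦ toCovector E (α z)) y v u := by
  have h1 : DifferentiableAt ℝ (fun z ↦ toCovector E (α z)) y :=
    ((contDiff_toCovector (n := 1)).differentiable (by simp)).differentiableAt.comp y h
  have h2 : ∀ v : E, fderiv ℝ (fun z ↦ α z ![v]) y =
      (ContinuousLinearMap.apply ℝ ℝ v).comp (fderiv ℝ (fun z ↦ toCovector E (α z)) y) := by
    intro v
    have h3 : HasFDerivAt (fun L : E →L[ℝ] ℝ ↦ L v) (ContinuousLinearMap.apply ℝ ℝ v)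
      (toCovector E (α y)) := (ContinuousLinearMap.apply ℝ ℝ v).hasFDerivAt
    refine HasFDerivAt.fderiv ((h3.comp y h1.hasFDerivAt).congr_of_eventuallyEq
      (Filter.Eventually.of_forall fun z ↦ (toCovector_apply _ _).symm))
  have h4 : (0 : Fin 2).removeNth ![u, v] = ![v] := by ext i; fin_cases i; rfl
  have h5 : (1 : Fin 2).removeNth ![u, v] = ![u] := by ext i; fin_cases i; rfl
  rw [extDeriv_apply h, Fin.sum_univ_two, h4, h5, h2, h2]
  simp [sub_eq_add_neg]

variable {d : ℕ} {M : Type*} [TopologicalSpace M] [ChartedSpace (EuclideanSpace ℝ (Fin d)) M]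
  {l β : DForm d M 1} {Ω : DForm d M 2}

lemma isSmooth_affinePath (hl : l.IsSmooth) (hβ : β.IsSmooth) (t : ℝ) :
    (affinePath l β t).IsSmooth :=
  hl.add (hβ.const_smul _)

lemma toCovector_inChart_affinePath (t : ℝ) (x₀ : M) (y : EuclideanSpace ℝ (Fin d)) :
    toCovector _ ((affinePath l β t).inChart x₀ y) =
      toCovector _ (l.inChart x₀ y) - t • toCovector _ (β.inChart x₀ y) := by
  have h : (affinePath l β t).inChart x₀ y = l.inChart x₀ y + (-t) • β.inChart x₀ y := rfl
  rw [h, map_add, map_smul]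
  ext v
  change toCovector _ (l.inChart x₀ y) v + -t * toCovector _ (β.inChart x₀ y) v =
    toCovector _ (l.inChart x₀ y) v - t * toCovector _ (β.inChart x₀ y) v
  ring

variable [IsManifold (𝓡 d) ∞ M]

/-- `extd` at a point uses the preferred chart there, so the identity is immediate only at the
centre of the chart. -/
lemma extDeriv_inChart_self {k : ℕ} (α : DForm d M k) (x : M) :
    extDeriv (α.inChart x) (extChartAt (𝓡 d) x x) = α.extd.inChart x (extChartAt (𝓡 d) x x) := by
  have hb := bijective_mfderiv_extChartAt (d := d) (mem_chart_source (EuclideanSpace ℝ (Fin d)) x)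
  have h := DForm.compCLM_mfderiv_extChartAt α.extd (mem_chart_source (EuclideanSpace ℝ (Fin d)) x)
  ext w
  choose w' hw' using fun i ↦ hb.2 (w i)
  obtain rfl : _ = w := funext hw'
  exact congrArg (fun L : (TangentSpace (𝓡 d) x) [⋀^Fin (k + 1)]→L[ℝ] ℝ ↦ L w') h.symm

/-- The derivative of the pullback of the path `l - t β` under the flow of the Moser field. -/
lemma hasDerivAt_affinePath_flow (hl : l.IsSmooth) (hβ : β.IsSmooth) (hΩ : Ω.IsSmooth)
    (hk : ∀ x, ∃ v : TangentSpace (𝓡 d) x, v ≠ 0 ∧ v ∈ Ω.ker x) {t₀ : ℝ}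
    (hext : (affinePath l β t₀).extd = Ω)
    (hn : ∀ x, Nondegenerate (affinePath l β t₀ x) (Ω x)) {Φ : ℝ × M → M}
    (hΦ : ContMDiff (𝓘(ℝ, ℝ).prod (𝓡 d)) (𝓡 d) ∞ Φ)
    (hΦt : ∀ x, HasMFDerivAt 𝓘(ℝ, ℝ) (𝓡 d) (fun s ↦ Φ (s, x)) t₀
      ((1 : ℝ →L[ℝ] ℝ).smulRight (moserField l β Ω t₀ (Φ (t₀, x))))) (x : M)
    (v : TangentSpace (𝓡 d) x) :
    HasDerivAt (fun t ↦ affinePath l β t (Φ (t, x))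
        ![mfderiv (𝓡 d) (𝓡 d) (fun z ↦ Φ (t, z)) x v])
      (-β (Φ (t₀, x)) ![reebField l β Ω t₀ (Φ (t₀, x))] * affinePath l β t₀ (Φ (t₀, x))
        ![mfderiv (𝓡 d) (𝓡 d) (fun z ↦ Φ (t₀, z)) x v]) t₀ := by
  -- Working in the chart centred at `c` means that `dl_t = Ω` is needed in coordinates only at the
  -- centre, where `extDeriv_inChart_self` provides it.
  set c := Φ (t₀, x) with hc
  have hs := mem_chart_source (EuclideanSpace ℝ (Fin d)) c
  have hsx := mem_chart_source (EuclideanSpace ℝ (Fin d)) x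
  have hinv : (extChartAt (𝓡 d) x).symm (extChartAt (𝓡 d) x x) = x := extChartAt_to_inv x
  let f : ℝ × EuclideanSpace ℝ (Fin d) → EuclideanSpace ℝ (Fin d) := fun q ↦
    extChartAt (𝓡 d) c (Φ (q.1, (extChartAt (𝓡 d) x).symm q.2))
  let a : EuclideanSpace ℝ (Fin d) → EuclideanSpace ℝ (Fin d) →L[ℝ] ℝ := fun y ↦
    toCovector _ (l.inChart c y)
  let b : EuclideanSpace ℝ (Fin d) → EuclideanSpace ℝ (Fin d) →L[ℝ] ℝ := fun y ↦
    toCovector _ (β.inChart c y)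
  let X : EuclideanSpace ℝ (Fin d) → EuclideanSpace ℝ (Fin d) := fun y ↦
    moserVector ((affinePath l β t₀).inChart c y) (Ω.inChart c y) (β.inChart c y)
  let u₀ := extChartAt (𝓡 d) x x
  let y₀ := extChartAt (𝓡 d) c c
  let w : EuclideanSpace ℝ (Fin d) :=
    mfderiv (𝓡 d) 𝓘(ℝ, EuclideanSpace ℝ (Fin d)) (extChartAt (𝓡 d) x) x v
  have hy₀ : f (t₀, u₀) = y₀ := by
    change extChartAt (𝓡 d) c (Φ (t₀, _)) = _
    rw [hinv]
  have ht := mem_extChartAt_target (I := 𝓡 d) c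
  have hfs : ∀ q : ℝ × EuclideanSpace ℝ (Fin d), q.2 ∈ (extChartAt (𝓡 d) x).target →
      Φ (q.1, (extChartAt (𝓡 d) x).symm q.2) ∈ (chartAt (EuclideanSpace ℝ (Fin d)) c).source →
      ContDiffAt ℝ ∞ f q := fun q hq1 hq2 ↦ by
    rw [← contMDiffAt_iff_contDiffAt]
    have h1 : ContMDiffAt 𝓘(ℝ, ℝ × EuclideanSpace ℝ (Fin d)) (𝓡 d) ∞
        (fun q : ℝ × EuclideanSpace ℝ (Fin d) ↦ (extChartAt (𝓡 d) x).symm q.2) q :=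
      ((contMDiffOn_extChartAt_symm x).contMDiffAt
        ((isOpen_extChartAt_target x).mem_nhds hq1)).comp q contDiffAt_snd.contMDiffAt
    exact (contMDiffAt_extChartAt' hq2).comp q
      (hΦ.contMDiffAt.comp q (contDiffAt_fst.contMDiffAt.prodMk h1))
  have hΦx : ∀ᶠ t in 𝓝 t₀, Φ (t, x) ∈ (chartAt (EuclideanSpace ℝ (Fin d)) c).source :=
    (hΦ.continuous.comp (by fun_prop : Continuous fun t : ℝ ↦ (t, x))).continuousAt.eventually
      ((chartAt (EuclideanSpace ℝ (Fin d)) c).open_source.mem_nhds hs)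
  have hfx : ∀ t, Φ (t, x) ∈ (chartAt (EuclideanSpace ℝ (Fin d)) c).source →
      ContDiffAt ℝ ∞ f (t, u₀) := fun t h ↦
    hfs _ (mem_extChartAt_target x) (by change Φ (t, (extChartAt (𝓡 d) x).symm u₀) ∈ _; rwa [hinv])
  have hder : ∀ t, Φ (t, x) ∈ (chartAt (EuclideanSpace ℝ (Fin d)) c).source →
      affinePath l β t (Φ (t, x)) ![mfderiv (𝓡 d) (𝓡 d) (fun z ↦ Φ (t, z)) x v] =
        (a (f (t, u₀)) - t • b (f (t, u₀))) (fderiv ℝ f (t, u₀) (0, w)) := fun t htx ↦ by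
    have hΦd : MDifferentiableAt (𝓡 d) (𝓡 d) (fun z ↦ Φ (t, z)) x :=
      (hΦ.contMDiffAt.comp x (contMDiffAt_const.prodMk contMDiffAt_id)).mdifferentiableAt
        (n := ∞) (by simp)
    have h1 := DForm.apply_mfderiv_eq_inChart (affinePath l β t) hΦd htx ![v]
    have h2 : HasFDerivAt (fun u ↦ f (t, u)) ((fderiv ℝ f (t, u₀)).comp
        (ContinuousLinearMap.inr ℝ ℝ (EuclideanSpace ℝ (Fin d)))) u₀ :=
      ((hfx t htx).differentiableAt (by simp)).hasFDerivAt.comp u₀ (hasFDerivAt_prodMk_right t u₀)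
    have h3 : mfderiv (𝓡 d) 𝓘(ℝ, EuclideanSpace ℝ (Fin d))
        (extChartAt (𝓡 d) c ∘ fun z ↦ Φ (t, z)) x v = fderiv ℝ f (t, u₀) (0, w) := by
      have h4 : (extChartAt (𝓡 d) c ∘ fun z ↦ Φ (t, z)) =ᶠ[𝓝 x]
          (fun u ↦ f (t, u)) ∘ extChartAt (𝓡 d) x := by
        filter_upwards [extChartAt_source_mem_nhds (I := 𝓡 d) x] with z hz
        simp only [Function.comp_apply, f, (extChartAt (𝓡 d) x).left_inv hz]
      have h6 := HasMFDerivAt.comp x (I' := 𝓘(ℝ, EuclideanSpace ℝ (Fin d))) h2.hasMFDerivAt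
        (mdifferentiableAt_extChartAt (I := 𝓡 d) hsx).hasMFDerivAt
      exact congrArg (fun L : EuclideanSpace ℝ (Fin d) →L[ℝ] EuclideanSpace ℝ (Fin d) ↦ L v)
        (h4.mfderiv_eq.trans h6.mfderiv)
    have h5 : f (t, u₀) = extChartAt (𝓡 d) c (Φ (t, x)) := by
      change extChartAt (𝓡 d) c (Φ (t, _)) = _
      rw [hinv]
    rw [h5]
    change _ = (toCovector _ (l.inChart c _) - t • toCovector _ (β.inChart c _)) _
    rw [← toCovector_inChart_affinePath, toCovector_apply, ← h3]
    refine Eq.trans (congrArg _ ?_) (h1.trans (congrArg _ ?_))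
    · ext i; fin_cases i; rfl
    · ext i; fin_cases i; rfl
  have hpair : ∀ z, z ∈ (chartAt (EuclideanSpace ℝ (Fin d)) c).source → _ := fun z hz ↦
    isMoserPair_inChart (l := l) (β := β) (Ω := Ω) (t := t₀) hz (hn z) (hk z)
  have hX : ContDiffAt ℝ ∞ X y₀ :=
    contDiffAt_moserVector ((isSmooth_affinePath hl hβ t₀).contDiffAt ht) (hΩ.contDiffAt ht)
      (hβ.contDiffAt ht) (isInvertible_moserOperator_inChart hs (hn c) (hk c))
  have hfX : ∀ᶠ u in 𝓝 u₀, fderiv ℝ f (t₀, u) (1, 0) = X (f (t₀, u)) := by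
    have h1 : ContinuousAt (fun u ↦ Φ (t₀, (extChartAt (𝓡 d) x).symm u)) u₀ :=
      hΦ.continuous.continuousAt.comp
        (continuousAt_const.prodMk (continuousAt_extChartAt_symm x))
    have h2 : Φ (t₀, (extChartAt (𝓡 d) x).symm u₀) ∈
      (chartAt (EuclideanSpace ℝ (Fin d)) c).source := by rw [hinv]; exact hs
    filter_upwards [(isOpen_extChartAt_target x).mem_nhds (mem_extChartAt_target x),
      h1.preimage_mem_nhds ((chartAt (EuclideanSpace ℝ (Fin d)) c).open_source.mem_nhds h2)]
      with u hu1 hu2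
    have h3 : HasFDerivAt (fun t ↦ f (t, u)) ((fderiv ℝ f (t₀, u)).comp
        (ContinuousLinearMap.inl ℝ ℝ (EuclideanSpace ℝ (Fin d)))) t₀ :=
      HasFDerivAt.comp (g := f) (f := fun t ↦ (t, u)) t₀
        ((hfs (t₀, u) hu1 hu2).differentiableAt (by simp)).hasFDerivAt (hasFDerivAt_prodMk_left t₀ u)
    have h4 := HasMFDerivAt.comp t₀ (mdifferentiableAt_extChartAt (I := 𝓡 d) hu2).hasMFDerivAt
      (hΦt ((extChartAt (𝓡 d) x).symm u))
    have h5 := congrArg (fun L : ℝ →L[ℝ] EuclideanSpace ℝ (Fin d) ↦ L 1)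
      (h3.unique (hasMFDerivAt_iff_hasFDerivAt.1 h4))
    refine Eq.trans h5 (Eq.trans ?_ (mfderiv_extChartAt_moserField hu2 (hn _) (hk _)).1)
    refine congrArg (mfderiv (𝓡 d) 𝓘(ℝ, EuclideanSpace ℝ (Fin d)) (extChartAt (𝓡 d) c) _) ?_
    exact one_smul ℝ _
  have hA : ∀ᶠ y in 𝓝 y₀, (a y - t₀ • b y) (X y) = 0 := by
    filter_upwards [(isOpen_extChartAt_target c).mem_nhds ht] with y hy
    have h1 := (hpair ((extChartAt (𝓡 d) c).symm y)
      (by rw [← extChartAt_source (𝓡 d)]; exact (extChartAt (𝓡 d) c).map_target hy)).apply_eq_zero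
    rw [(extChartAt (𝓡 d) c).right_inv hy] at h1
    change (toCovector _ (l.inChart c _) - t₀ • toCovector _ (β.inChart c _)) _ = 0
    rw [← toCovector_inChart_affinePath, toCovector_apply]
    exact h1
  have hfun : (fun y ↦ a y - t₀ • b y) = fun y ↦ toCovector _ ((affinePath l β t₀).inChart c y) :=
    funext fun y ↦ (toCovector_inChart_affinePath t₀ c y).symm
  have hd : ∀ q, fderiv ℝ (fun y ↦ a y - t₀ • b y) y₀ (X y₀) q -
      fderiv ℝ (fun y ↦ a y - t₀ • b y) y₀ q (X y₀) =
        b y₀ q - β c ![reebField l β Ω t₀ c] * (a y₀ - t₀ • b y₀) q := fun q ↦ by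
    have h1 := (hpair c hs).contract_eq q
    rw [hfun, ← extDeriv_oneForm_apply ((isSmooth_affinePath hl hβ t₀).differentiableAt_self c),
      extDeriv_inChart_self, hext]
    refine h1.trans ?_
    have h2 : a y₀ - t₀ • b y₀ = toCovector _ ((affinePath l β t₀).inChart c y₀) :=
      congrFun hfun y₀
    have h3 := DForm.apply_eq_inChart β hs ![reebField l β Ω t₀ c]
    rw [h2, h3]
    refine congrArg₂ _ (toCovector_apply _ _).symm (congrArg₂ _ (congrArg _ ?_)
      (toCovector_apply _ _).symm)
    ext i; fin_cases i
    exact congrArg (fun z : EuclideanSpace ℝ (Fin d) ↦ z _)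
      (mfderiv_extChartAt_moserField hs (hn c) (hk c)).2.symm
  have hcov : ∀ {γ : DForm d M 1}, γ.IsSmooth →
      DifferentiableAt ℝ (fun y ↦ toCovector _ (γ.inChart c y)) y₀ := fun hγ ↦
    (contDiffAt_toCovector (hγ.contDiffAt ht)).differentiableAt (by simp)
  have hmain := hasDerivAt_apply_fderiv ((hfx t₀ hs).of_le (WithTop.coe_le_coe.2 le_top)) hy₀
    (hcov hl) (hcov hβ) (hX.differentiableAt (by simp)) hfX hA hd w
  rw [hder t₀ hs, hy₀]
  refine hmain.congr_of_eventuallyEq ?_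
  filter_upwards [hΦx] with t htx
  exact hder t htx

end Gray

/-! ### Gray stability and the main theorem -/

section GrayStability

variable {d : ℕ} {M : Type*} [TopologicalSpace M] [ChartedSpace (EuclideanSpace ℝ (Fin d)) M]
  {l β : DForm d M 1} {Ω : DForm d M 2}

/-- The map is a variable with `F = id`, so that substitution also acts on the types depending on `F
x`. -/
lemma affinePath_zero_apply_mfderiv (l β : DForm d M 1) {F : M → M} (hF : F = id) (x : M)
    (v : TangentSpace (𝓡 d) x) :
    affinePath l β 0 (F x) ![mfderiv (𝓡 d) (𝓡 d) F x v] = l x ![v] := by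
  subst hF
  rw [mfderiv_id]
  change l x ![v] + -0 * β x ![v] = l x ![v]
  ring

/-- This identifies the direction of the path as `β = l + ρ^* l`, which does not depend on `t`. -/
lemma linearPath_eq_affinePath (ρ : M → M) (l : DForm d M 1) (t : ℝ) :
    linearPath ρ l t = affinePath l (l + DForm.pullback ρ l) t := by
  funext x
  ext w
  change (1 - t) * l x w - t * DForm.pullback ρ l x w =
    l x w + -t * (l x w + DForm.pullback ρ l x w)
  ring

/-- An isotopy can be run at half speed. -/
lemma IsSmoothIsotopy.half {φ : ℝ → (M ≃ₘ⟮𝓡 d, 𝓡 d⟯ M)} (hφ : IsSmoothIsotopy φ) :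
    IsSmoothIsotopy fun t ↦ φ (t / 2) where
  map_zero x := by rw [zero_div]; exact hφ.map_zero x
  smooth := by
    have h : ContMDiff (𝓘(ℝ, ℝ).prod (𝓡 d)) (𝓘(ℝ, ℝ).prod (𝓡 d)) ∞
        (fun p : ℝ × M ↦ (p.1 / 2, p.2)) := by
      have h1 : ContMDiff 𝓘(ℝ, ℝ) 𝓘(ℝ, ℝ) ∞ fun t : ℝ ↦ t / 2 :=
        (contDiff_id.div_const 2).contMDiff
      exact (h1.comp contMDiff_fst).prodMk contMDiff_snd
    refine hφ.smooth.comp h.contMDiffOn fun p hp ↦ ⟨⟨?_, ?_⟩, trivial⟩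
    · change 0 ≤ p.1 / 2
      linarith [hp.1.1]
    · change p.1 / 2 ≤ 1
      linarith [hp.1.1, hp.1.2]

variable [IsManifold (𝓡 d) ∞ M] [T2Space M] [CompactSpace M]

/-- **Gray stability** for a path `l - t β` of primitives of `Ω` which do not vanish on
`ker Ω ∖ 0`. -/
theorem exists_isotopy_mapsDistribution (hl : l.IsSmooth) (hβ : β.IsSmooth) (hΩ : Ω.IsSmooth)
    (hk : ∀ x, ∃ v : TangentSpace (𝓡 d) x, v ≠ 0 ∧ v ∈ Ω.ker x)
    (hext : ∀ t ∈ Icc (0 : ℝ) 1, (affinePath l β t).extd = Ω)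
    (hn : ∀ t ∈ Icc (0 : ℝ) 1, ∀ x, Nondegenerate (affinePath l β t x) (Ω x)) :
    ∃ φ : ℝ → (M ≃ₘ⟮𝓡 d, 𝓡 d⟯ M), IsSmoothIsotopy φ ∧
      ∀ t ∈ Icc (0 : ℝ) 1, MapsDistribution (φ t) l.ker (affinePath l β t).ker := by
  -- Compactness of `M` and the tube lemma give an open set of times around `[0, 1]` on which
  -- nondegeneracy, hence smoothness of the Moser field, holds on all of `M`.
  obtain ⟨T, U, hT, -, hT01, hU, hTU⟩ := generalized_tube_lemma (isCompact_Icc (a := (0 : ℝ))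
    (b := 1)) (isCompact_univ (X := M)) (isOpen_setOf_nondegenerate hl hβ hΩ hk)
    (fun p hp ↦ hn p.1 hp.1 p.2)
  obtain ⟨Φ, hΦ, hΦ0, hΦt, hΦd⟩ := exists_isotopy_of_timeDependent (V := moserField l β Ω) hT hT01
    (fun p hp ↦ (contMDiffAt_moserField hl hβ hΩ hk
      (hTU ⟨hp.1, hU (mem_univ _)⟩)).contMDiffWithinAt)
  have : Nonempty (M ≃ₘ⟮𝓡 d, 𝓡 d⟯ M) := ⟨Diffeomorph.refl _ _ _⟩
  -- Outside `[0, 1]` the chosen diffeomorphisms are arbitrary.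
  choose! φ hφ using hΦd
  have h0 : (0 : ℝ) ∈ Icc (0 : ℝ) 1 := ⟨le_rfl, zero_le_one⟩
  refine ⟨φ, ⟨fun x ↦ by rw [hφ 0 h0, hΦ0], hΦ.contMDiffOn.congr fun p hp ↦ hφ _ hp.1 _⟩,
    fun t ht x ↦ ?_⟩
  have hfun : ⇑(φ t) = fun z ↦ Φ (t, z) := funext (hφ t ht)
  have hbij : Function.Bijective (mfderiv (𝓡 d) (𝓡 d) (φ t) x) :=
    ((φ t).mfderivToContinuousLinearEquiv (by simp) x).bijective
  rw [hfun] at hbij ⊢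
  have hiff : ∀ v : TangentSpace (𝓡 d) x, l x ![v] = 0 ↔
      affinePath l β t (Φ (t, x)) ![mfderiv (𝓡 d) (𝓡 d) (fun z ↦ Φ (t, z)) x v] = 0 := fun v ↦ by
    have hmem : ∀ s ∈ Icc 0 t, s ∈ Icc (0 : ℝ) 1 := fun s hs ↦ ⟨hs.1, hs.2.trans ht.2⟩
    have h := eq_zero_iff_of_hasDerivAt_mul ht.1
      (r := fun s ↦ β (Φ (s, x)) ![reebField l β Ω s (Φ (s, x))]) (fun s hs ↦ ?_)
      (fun s hs ↦ hasDerivAt_affinePath_flow hl hβ hΩ hk (hext s (hmem s hs)) (hn s (hmem s hs))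
        hΦ (hΦt s (hmem s hs)) x v)
    · rw [affinePath_zero_apply_mfderiv l β (funext hΦ0)] at h
      exact h
    · have hc : ContinuousAt (fun s : ℝ ↦ (s, Φ (s, x))) s :=
        (continuous_id.prodMk (hΦ.continuous.comp (continuous_id.prodMk
          continuous_const))).continuousAt
      exact (ContinuousAt.comp (f := fun s : ℝ ↦ (s, Φ (s, x)))
        (continuousAt_apply_reebField hl hβ hΩ hk (p := (s, Φ (s, x)))
          (hn s (hmem s hs) _)) hc).continuousWithinAt
  ext w
  obtain ⟨v, rfl⟩ := hbij.2 w
  constructor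
  · rintro ⟨v', hv', h⟩
    obtain rfl := hbij.1 h
    exact DForm.mem_ker_one.2 ((hiff v').1 (DForm.mem_ker_one.1 hv'))
  · intro h
    exact ⟨v, DForm.mem_ker_one.2 ((hiff v).2 (DForm.mem_ker_one.1 h)), rfl⟩

end GrayStability

end

theorem mainTheorem2 (n : ℕ) (hn : 1 ≤ n)
    {M : Type*} [TopologicalSpace M] [ChartedSpace (EuclideanSpace ℝ (Fin (2 * n - 1))) M]
    [IsManifold (𝓡 (2 * n - 1)) ∞ M] [T2Space M] [CompactSpace M] [ConnectedSpace M]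
    (Ω : DForm (2 * n - 1) M 2) (hΩ : IsHamiltonianStructure Ω)
    (ρ : M → M) (hρ : IsRealStructure Ω ρ)
    (l : DForm (2 * n - 1) M 1) (hl : IsContactForm n Ω l) :
    DForm.pullback ρ (antisymmetrization ρ l) = -antisymmetrization ρ l ∧
    IsContactForm n Ω (antisymmetrization ρ l) ∧
    AreIsotopic l.ker (antisymmetrization ρ l).ker ∧
    linearPath ρ l 0 = l ∧ linearPath ρ l (1 / 2) = antisymmetrization ρ l ∧
    (∀ t ∈ Icc (0 : ℝ) 1, IsContactForm n Ω (linearPath ρ l t)) ∧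
    ∃ φ : ℝ → (M ≃ₘ⟮𝓡 (2 * n - 1), 𝓡 (2 * n - 1)⟯ M), IsSmoothIsotopy φ ∧
      ∀ t ∈ Icc (0 : ℝ) 1, MapsDistribution (φ t) l.ker (linearPath ρ l t).ker := by
  -- The subtractions are truncated; this is where `1 ≤ n` enters.
  have hd : 2 * n - 1 = 1 + 2 * (n - 1) := by omega
  have hhalf : (1 / 2 : ℝ) ∈ Icc (0 : ℝ) 1 := by norm_num
  have hcontact : ∀ t ∈ Icc (0 : ℝ) 1, IsContactForm n Ω (linearPath ρ l t) := fun t ht ↦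
    isContactForm_linearPath hd hΩ.finrank_ker hρ hl ht
  obtain ⟨φ, hφ, hφt⟩ := exists_isotopy_mapsDistribution (l := l) (β := l + DForm.pullback ρ l)
    (Ω := Ω) hl.smooth (hl.smooth.add (DForm.IsSmooth.pullback hρ.smooth hl.smooth)) hΩ.smooth
    (exists_ne_zero_mem_ker hΩ.finrank_ker)
    (fun t ht ↦ by rw [← linearPath_eq_affinePath]; exact (hcontact t ht).extd_eq)
    (fun t ht x v hv hlv ↦ by
      rw [← linearPath_eq_affinePath] at hlv
      by_contra hv0
      exact (hcontact t ht).apply_ne_zero hd hv0 (DForm.mem_ker_two.2 hv) hlv)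
  simp only [← linearPath_eq_affinePath] at hφt
  refine ⟨pullback_antisymmetrization
    (DForm.pullback_pullback_of_involutive hρ.smooth hρ.involutive l), ?_, ?_, linearPath_zero ρ l,
    linearPath_half ρ l, hcontact, φ, hφ, hφt⟩
  · rw [← linearPath_half]
    exact hcontact _ hhalf
  -- At half speed the time-one map is `φ (1 / 2)`, which carries `ker l` to the kernel of the
  -- midpoint form.
  · refine ⟨fun t ↦ φ (t / 2), hφ.half, ?_⟩
    rw [← linearPath_half]
    exact hφt _ hhalf
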